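/- A deterministic algorithm for metric $1$-median is a uniform (Turing-computably controlled) real-RAM algorithm that is given $n\ge 1$ and may query the distances $d(x,y)$ of an $n$-point metric space $(M,d)$, $M$ labelled by $n$ indices; it may compare exact arithmetic expressions in the answers, and it always halts and outputs a point of $M$. It is an $o(n)$-query algorithm if on all $n$-point metric spaces it makes at most $q(n)$ queries, for some $q(n)=o(n)$. A point $p$ is a $\beta$-approximate $1$-median of $(M,d)$ if $\sum_{y\in M} d(p,y)\le\beta\cdot\min_{z\in M}\sum_{y\in M} d(z,y)$; the algorithm is $h(n)$-approximate if for all $n\ge 1$ it outputs an $h(n)$-approximate $1$-median of every $n$-point metric space, and $o(g(n))$-approximate if it is $h(n)$-approximate for some $h(n)=o(g(n))$. Its approximation ratio $\rho_A(n)$ is the least $\beta\ge 1$ such that the output of $A$ is a $\beta$-approximate $1$-median of every $n$-point metric space. **Corollary.** No deterministic $o(n)$-query algorithm for metric $1$-median has an asymptotically best approximation ratio: there is no deterministic $o(n)$-query algorithm $A$ such that $\rho_A=O(\rho_B)$ for every deterministic $o(n)$-query algorithm $B$. More precisely, for every deterministic $o(n)$-query algorithm $A$ there are a computable function $f_A\colon\mathbb{Z}^+\to\mathbb{Z}^+$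 with $f_A(n)=\omega(1)$ and a deterministic $o(n)$-query algorithm $B$ such that $A$ is not $o(f_A(n)\cdot\log n)$-approximate, $B$ is $o(\sqrt{f_A(n)}\cdot\log n)$-approximate, and $\rho_B(n)=o(\rho_A(n))$. -/

import Mathlib

open Filter Asymptotics

namespace MetricMedian

/-- A polynomial with integer coefficients in the variables `a 0, a 1, …`, as a list of monomials:
`(c, [i₁, …, iₖ])` stands for `c * a i₁ * ⋯ * a iₖ`. -/
abbrev RealPoly := List (ℤ × List ℕ)

/-- The value of a polynomial when the variable with index `i` is the `i`-th entry of `a`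
(variables beyond the end of the list are read as `0`). -/
noncomputable def RealPoly.eval (P : RealPoly) (a : List ℝ) : ℝ :=
  (P.map fun t => (t.1 : ℝ) * (t.2.map fun i => a.getD i 0).prod).sum

/-- An instruction: output a point, query the distance of two points, or test whether a polynomial
in the answers received so far is nonnegative. -/
abbrev Instr := ℕ ⊕ (ℕ × ℕ) ⊕ RealPoly

/-- Halt and output the point `p`. -/
abbrev Instr.output (p : ℕ) : Instr := Sum.inl p

/-- Query the distance between the points `x` and `y`. -/
abbrev Instr.query (x y : ℕ) : Instr := Sum.inr (Sum.inl (x, y))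

/-- Test whether `P` is nonnegative at the answers received so far. -/
abbrev Instr.test (P : RealPoly) : Instr := Sum.inr (Sum.inr P)

/-- A (uniform) deterministic algorithm with query access to a metric on `n` points, in the
real-RAM model. The control is Turing computable: from the number `n` of points and the history of
the run it computes the next instruction. Real numbers (the answers to the queries) are accessible
only through exact arithmetic and comparisons, i.e. through sign tests of polynomials with integer
coefficients. The history has one bit per executed instruction: the result of the test for a test,
and `true` for a query. -/
structure Algorithm where
  /-- the next instruction, from the number of points and the history -/
  next : ℕ → List Bool → Instr
  computable_next : Computable₂ next

namespace Algorithm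

open Classical in
/-- `A.Reaches m h a`: when `A` runs on the `n`-point metric space `(Fin n, m)`, it arrives at the
history `h`, having made `a.length` queries with the answers `a` (in this order). There is no rule
for a query of a point outside the space. -/
inductive Reaches (A : Algorithm) {n : ℕ} (m : MetricSpace (Fin n)) :
    List Bool → List ℝ → Prop
  | start : Reaches A m [] []
  | query {h : List Bool} {a : List ℝ} (x y : Fin n) :
      Reaches A m h a → A.next n h = Instr.query x y →
      Reaches A m (h ++ [true]) (a ++ [m.dist x y])
  | test {h : List Bool} {a : List ℝ} (P : RealPoly) :
      Reaches A m h a → A.next n h = Instr.test P →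
      Reaches A m (h ++ [decide (0 ≤ P.eval a)]) a

/-- On `(Fin n, m)` the algorithm halts with output `p` after exactly `k` queries. -/
def HaltsWith (A : Algorithm) {n : ℕ} (m : MetricSpace (Fin n)) (p : Fin n) (k : ℕ) : Prop :=
  ∃ h a, A.Reaches m h a ∧ A.next n h = Instr.output p ∧ a.length = k

/-- An `o(n)`-query algorithm: it halts, with a point of the space as output, on every nonempty
finite metric space, and the number of queries on `n`-point spaces is at most `q n`
with `q n = o(n)`. -/
def IsSublinearQuery (A : Algorithm) : Prop :=
  ∃ q : ℕ → ℕ, (fun n => (q n : ℝ)) =o[atTop] (fun n => (n : ℝ)) ∧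
    ∀ n, 1 ≤ n → ∀ m : MetricSpace (Fin n), ∃ p k, A.HaltsWith m p k ∧ k ≤ q n

end Algorithm

/-- `p` is a `β`-approximate `1`-median of `(Fin n, m)`. -/
def IsApproxMedian {n : ℕ} (m : MetricSpace (Fin n)) (β : ℝ) (p : Fin n) : Prop :=
  ∀ z : Fin n, ∑ y, m.dist p y ≤ β * ∑ y, m.dist z y

namespace Algorithm

/-- On all `n`-point metric spaces the algorithm outputs a `β`-approximate `1`-median. -/
def IsApproxAt (A : Algorithm) (n : ℕ) (β : ℝ) : Prop :=
  ∀ m : MetricSpace (Fin n), ∃ p k, A.HaltsWith m p k ∧ IsApproxMedian m β p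

/-- The algorithm is `o(g(n))`-approximate: it is `h(n)`-approximate for some `h(n) = o(g(n))`. -/
def IsLittleOApprox (A : Algorithm) (g : ℕ → ℝ) : Prop :=
  ∃ h : ℕ → ℝ, h =o[atTop] g ∧ ∀ n, 1 ≤ n → A.IsApproxAt n (h n)

/-- The worst-case approximation ratio on `n`-point metric spaces: the least `β ≥ 1` for which the
algorithm is `β`-approximate. (If the algorithm always halts, such `β` exist for `n ≥ 1`,
as every point is a `max 1 (n - 1)`-approximate `1`-median.) -/
noncomputable def ratio (A : Algorithm) (n : ℕ) : ℝ :=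
  sInf {β : ℝ | 1 ≤ β ∧ A.IsApproxAt n β}

/-- The algorithm has an asymptotically best approximation ratio among the deterministic
`o(n)`-query algorithms: up to a constant factor, no such algorithm has a better one. -/
def IsAsymptoticallyBest (A : Algorithm) : Prop :=
  A.IsSublinearQuery ∧ ∀ B : Algorithm, B.IsSublinearQuery → A.ratio =O[atTop] B.ratio

end Algorithm

end MetricMedian

/-! The lower bound comes from an adversary. It keeps extended distances `d`, at first ⊤ between
different points, and measures around each point s the crowd Σ_t 2^(-d(s,t)); `pot` is its binary
logarithm, rounded up. A query of x, y is answered by d(x,y) or, if smaller, by the weight w =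
max(1, pot x + pot y), which becomes a new edge. Then 2^(-w) · crowd x · crowd y ≤ 1, and this keeps
every crowd O(√q) after q ≥ 1 queries and the sum of all crowds at most n + 2q (`IsTame.update`).

Since `pot` is 1-Lipschitz, a hub can be attached afterwards at any 1-Lipschitz distances l ≥ pot
without changing an answer (`IsCompatible.eq_answer`). Once the output p is known, l = max(pot, r -
d(p,·)) with r = ⌊⌊log₂ n⌋/8⌋ keeps p at distance at least r from the hub, while Σ l ≤ 4q + r · 2^r
· crowd p. A point z that was never queried lies at the hub, so its distance sum is O(n/f), where f
is about min(n/(q+1), 2^r), whereas the sums of p and z together are at least nr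
(`IsTame.exists_isBadChoice`). Hence the ratio is Ω(f log n).

The function f has to be computable although the bound on the number of queries need not be. All
distances of the adversary are natural numbers, so a bad run is a finite certificate that can be
verified. The search for one terminates, and the number of queries in the certificate found defines
f (`exists_computable_sparsity`). The certificate describes a genuine run, so it respects the query
bound and f tends to infinity.

For the upper bound, the edges of a de Bruijn graph on 2^H sampled points, about n/k, are queried.
Every ordered pair is joined by a canonical walk of H edges, and these walks use all edges equally
often. A point with the least total walk length is an O(k log n)-approximate median by averaging and
the triangle inequality (`dist_le_of_score_le`). With k about f^(1/4) this takes o(n) queries and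
has ratio o(√f · log n), which is o(f log n) and so beats the given algorithm. -/

namespace MetricMedian

/-! ### Determinism of runs and the approximation ratio -/

namespace Algorithm

variable {A : Algorithm} {n : ℕ}

/-- Determinism: the history fixes the next instruction, and the metric fixes its result. Runs on
the same metric can therefore be compared by length alone. -/
theorem Reaches.eq_of_length_eq {m : MetricSpace (Fin n)} {h h' : List Bool} {a a' : List ℝ}
    (H : A.Reaches m h a) (H' : A.Reaches m h' a') (hl : h.length = h'.length) :
    h = h' ∧ a = a' := by
  induction H generalizing h' a' with
  | start =>
    cases H' with
    | start => exact ⟨rfl, rfl⟩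
    | query => simp at hl
    | test => simp at hl
  | query x y H hn ih =>
    cases H' with
    | start => simp at hl
    | query x' y' H' hn' =>
      obtain ⟨rfl, rfl⟩ := ih H' (by simpa using hl)
      rw [hn] at hn'
      simp only [Sum.inr.injEq, Sum.inl.injEq, Prod.mk.injEq, Fin.val_inj] at hn'
      obtain ⟨rfl, rfl⟩ := hn'
      exact ⟨rfl, rfl⟩
    | test P' H' hn' =>
      obtain ⟨rfl, rfl⟩ := ih H' (by simpa using hl)
      rw [hn] at hn'
      simp at hn'
  | test P H hn ih =>
    cases H' with
    | start => simp at hl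
    | query x' y' H' hn' =>
      obtain ⟨rfl, rfl⟩ := ih H' (by simpa using hl)
      rw [hn] at hn'
      simp at hn'
    | test P' H' hn' =>
      obtain ⟨rfl, rfl⟩ := ih H' (by simpa using hl)
      rw [hn] at hn'
      simp only [Sum.inr.injEq] at hn'
      subst hn'
      exact ⟨rfl, rfl⟩

theorem Reaches.length_le_of_output {m : MetricSpace (Fin n)} {h h' : List Bool} {a a' : List ℝ}
    {p : ℕ} (H : A.Reaches m h a) (hp : A.next n h = Instr.output p) (H' : A.Reaches m h' a') :
    h'.length ≤ h.length := by
  induction H' with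
  | start => simp
  | query x y H' hn ih =>
    rcases ih.lt_or_eq with hlt | heq
    · simpa using hlt
    · obtain ⟨rfl, -⟩ := H.eq_of_length_eq H' heq.symm
      rw [hp] at hn
      simp at hn
  | test P H' hn ih =>
    rcases ih.lt_or_eq with hlt | heq
    · simpa using hlt
    · obtain ⟨rfl, -⟩ := H.eq_of_length_eq H' heq.symm
      rw [hp] at hn
      simp at hn

theorem HaltsWith.unique {m : MetricSpace (Fin n)} {p p' : Fin n} {k k' : ℕ}
    (H : A.HaltsWith m p k) (H' : A.HaltsWith m p' k') : p = p' ∧ k = k' := by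
  obtain ⟨h, a, hr, hp, rfl⟩ := H
  obtain ⟨h', a', hr', hp', rfl⟩ := H'
  obtain ⟨rfl, rfl⟩ := hr.eq_of_length_eq hr'
    (le_antisymm (hr'.length_le_of_output hp' hr) (hr.length_le_of_output hp hr'))
  rw [hp] at hp'
  simp only [Sum.inl.injEq, Fin.val_inj] at hp'
  exact ⟨hp', rfl⟩

/-- The number of answers received never exceeds the number of queries of the full run. -/
theorem Reaches.length_answers_le {m : MetricSpace (Fin n)} {h : List Bool} {a : List ℝ}
    {h' : List Bool} {a' : List ℝ} (H : A.Reaches m h a) (H' : A.Reaches m h' a')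
    (hl : h.length ≤ h'.length) : a.length ≤ a'.length := by
  induction H' with
  | start =>
    obtain ⟨-, rfl⟩ := H.eq_of_length_eq .start (by simpa using hl)
    simp
  | query x y H' hn ih =>
    rcases hl.lt_or_eq with hlt | heq
    · have := ih (by simpa [Nat.lt_succ_iff] using hlt)
      simp only [List.length_append, List.length_cons, List.length_nil]
      omega
    · obtain ⟨-, rfl⟩ := H.eq_of_length_eq (.query x y H' hn) heq
      exact le_rfl
  | test P H' hn ih =>
    rcases hl.lt_or_eq with hlt | heq
    · exact ih (by simpa [Nat.lt_succ_iff] using hlt)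
    · obtain ⟨-, rfl⟩ := H.eq_of_length_eq (.test P H' hn) heq
      exact le_rfl

theorem Reaches.length_answers_le_of_haltsWith {m : MetricSpace (Fin n)} {h : List Bool}
    {a : List ℝ} {p : Fin n} {k : ℕ} (H : A.Reaches m h a) (H' : A.HaltsWith m p k) :
    a.length ≤ k := by
  obtain ⟨h', a', hr', hp', rfl⟩ := H'
  exact H.length_answers_le hr' (hr'.length_le_of_output hp' H)

end Algorithm

theorem IsApproxMedian.mono {n : ℕ} {m : MetricSpace (Fin n)} {β γ : ℝ} {p : Fin n}
    (h : IsApproxMedian m β p) (hβ : β ≤ γ) : IsApproxMedian m γ p := fun z =>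
  (h z).trans (mul_le_mul_of_nonneg_right hβ
    (Finset.sum_nonneg fun y _ => @dist_nonneg _ m.toPseudoMetricSpace z y))

theorem Algorithm.IsApproxAt.mono {A : Algorithm} {n : ℕ} {β γ : ℝ} (h : A.IsApproxAt n β)
    (hβ : β ≤ γ) : A.IsApproxAt n γ := fun m => by
  obtain ⟨p, k, hp, hm⟩ := h m
  exact ⟨p, k, hp, hm.mono hβ⟩

/-- Every point is an `(n + 1)`-approximate `1`-median. -/
theorem isApproxMedian_add_one {n : ℕ} (m : MetricSpace (Fin n)) (p : Fin n) :
    IsApproxMedian m (n + 1) p := by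
  intro z
  have tri : ∀ x y w, m.dist x y ≤ m.dist x w + m.dist w y := fun x y w =>
    @dist_triangle _ m.toPseudoMetricSpace x w y
  have hz : m.dist p z ≤ ∑ y, m.dist z y := by
    have h1 := Finset.single_le_sum (f := fun y => m.dist z y)
      (fun y _ => @dist_nonneg _ m.toPseudoMetricSpace z y) (Finset.mem_univ p)
    rw [show m.dist p z = m.dist z p from @dist_comm _ m.toPseudoMetricSpace p z]
    exact h1
  calc ∑ y, m.dist p y ≤ ∑ y, (m.dist p z + m.dist z y) :=
        Finset.sum_le_sum fun y _ => tri p y z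
    _ = n * m.dist p z + ∑ y, m.dist z y := by simp [Finset.sum_add_distrib]
    _ ≤ n * ∑ y, m.dist z y + ∑ y, m.dist z y := by gcongr
    _ = (n + 1) * ∑ y, m.dist z y := by ring

namespace Algorithm

theorem ratio_le {A : Algorithm} {n : ℕ} {β : ℝ} (hβ : 1 ≤ β) (h : A.IsApproxAt n β) :
    A.ratio n ≤ β :=
  csInf_le ⟨1, fun _ hx => hx.1⟩ ⟨hβ, h⟩

/-- The infimum of the empty set is 0 by convention, so a lower bound needs some admissible β; the
crude factor n + 1 is one. -/
theorem le_ratio {A : Algorithm} (hA : A.IsSublinearQuery) {n : ℕ} (hn : 1 ≤ n) {c : ℝ}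
    (h : ∀ β, 1 ≤ β → A.IsApproxAt n β → c ≤ β) : c ≤ A.ratio n := by
  obtain ⟨q, -, hq⟩ := hA
  refine le_csInf ⟨n + 1, by simp, fun m => ?_⟩ fun β hβ => h β hβ.1 hβ.2
  obtain ⟨p, k, hp, -⟩ := hq n hn m
  exact ⟨p, k, hp, isApproxMedian_add_one m p⟩

end Algorithm

end MetricMedian

/-! ### The adversary: crowds, potentials and answers -/

namespace MetricMedian

/-- `2 ^ (-a)` for an extended natural number `a`. -/
noncomputable def decay (a : ℕ∞) : ℝ := if a = ⊤ then 0 else (1 / 2) ^ a.toNat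

@[simp] theorem decay_top : decay ⊤ = 0 := if_pos rfl

@[simp] theorem decay_coe (k : ℕ) : decay k = (1 / 2) ^ k := by simp [decay]

@[simp] theorem decay_zero : decay 0 = 1 := by simpa using decay_coe 0

theorem decay_nonneg (a : ℕ∞) : 0 ≤ decay a := by
  unfold decay
  split_ifs <;> positivity

theorem decay_add (a b : ℕ∞) : decay (a + b) = decay a * decay b := by
  induction a using ENat.recTopCoe with
  | top => simp
  | coe a =>
    induction b using ENat.recTopCoe with
    | top => simp
    | coe b => rw [← Nat.cast_add, decay_coe, decay_coe, decay_coe, pow_add]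

theorem decay_anti {a b : ℕ∞} (h : a ≤ b) : decay b ≤ decay a := by
  induction b using ENat.recTopCoe with
  | top => simpa using decay_nonneg a
  | coe b =>
    induction a using ENat.recTopCoe with
    | top => simp at h
    | coe a =>
      rw [decay_coe, decay_coe]
      exact pow_le_pow_of_le_one (by norm_num) (by norm_num) (by exact_mod_cast h)

theorem decay_min_le (a b : ℕ∞) : decay (min a b) ≤ decay a + decay b := by
  rcases min_choice a b with h | h <;> rw [h]
  · linarith [decay_nonneg b]
  · linarith [decay_nonneg a]

variable {V : Type*}

/-- A metric with values in the extended natural numbers. -/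
structure IsExtMetric (d : V → V → ℕ∞) : Prop where
  eq_zero_iff : ∀ s t, d s t = 0 ↔ s = t
  symm : ∀ s t, d s t = d t s
  triangle : ∀ s t u, d s u ≤ d s t + d t u

theorem IsExtMetric.self {d : V → V → ℕ∞} (hd : IsExtMetric d) (s : V) : d s s = 0 :=
  (hd.eq_zero_iff s s).2 rfl

/-- Add an edge of length `w` between `x` and `y`. -/
noncomputable def addEdge (d : V → V → ℕ∞) (w : ℕ) (x y s t : V) : ℕ∞ :=
  min (d s t) (min (d s x + w + d y t) (d s y + w + d x t))

theorem IsExtMetric.addEdge {d : V → V → ℕ∞} (hd : IsExtMetric d) {w : ℕ} (hw : 1 ≤ w)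
    (x y : V) : IsExtMetric (addEdge d w x y) where
  eq_zero_iff s t := by
    have hw' : (w : ℕ∞) ≠ 0 := by
      simpa using (by omega : w ≠ 0)
    rw [MetricMedian.addEdge, ← hd.eq_zero_iff s t]
    constructor
    · intro h
      rcases min_choice (d s t) (min (d s x + w + d y t) (d s y + w + d x t)) with h1 | h1
      · rwa [h1] at h
      · rw [h1] at h
        rcases min_choice (d s x + w + d y t) (d s y + w + d x t) with h2 | h2 <;>
        · rw [h2] at h
          simp [hw'] at h
    · intro h
      simp [h]
  symm s t := by
    rw [MetricMedian.addEdge, MetricMedian.addEdge, hd.symm s t, hd.symm s x, hd.symm s y,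
      hd.symm y t, hd.symm x t]
    congr 1
    rw [min_comm]
    congr 1 <;> ring
  triangle s t u := by
    have tri := hd.triangle
    simp only [MetricMedian.addEdge, min_add, add_min, le_min_iff]
    -- One case for each way the two legs use the new edge. Crossing it twice in the same direction
    -- shortens to a single crossing, crossing it back and forth to a path of `d`.
    refine ⟨⟨?_, ?_, ?_⟩, ⟨?_, ?_, ?_⟩, ?_, ?_, ?_⟩
    · exact (min_le_left _ _).trans (tri s t u)
    · refine (min_le_right _ _).trans ((min_le_left _ _).trans ?_)
      calc d s x + w + d y u ≤ d s x + w + (d y t + d t u) := by gcongr; exact tri _ _ _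
        _ = _ := by ring
    · refine (min_le_right _ _).trans ((min_le_right _ _).trans ?_)
      calc d s y + w + d x u ≤ d s y + w + (d x t + d t u) := by gcongr; exact tri _ _ _
        _ = _ := by ring
    · refine (min_le_right _ _).trans ((min_le_left _ _).trans ?_)
      calc d s x + w + d y u ≤ (d s t + d t x) + w + d y u := by gcongr; exact tri _ _ _
        _ = _ := by ring
    · refine (min_le_right _ _).trans ((min_le_left _ _).trans ?_)
      calc d s x + w + d y u ≤ d s x + w + d y u + (d y t + d t x + w) := le_self_add
        _ = _ := by ring
    · refine (min_le_left _ _).trans ?_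
      calc d s u ≤ d s y + d y u := tri _ _ _
        _ ≤ d s y + d y u + (w + d x t + d t x + w) := le_self_add
        _ = _ := by ring
    · refine (min_le_right _ _).trans ((min_le_right _ _).trans ?_)
      calc d s y + w + d x u ≤ (d s t + d t y) + w + d x u := by gcongr; exact tri _ _ _
        _ = _ := by ring
    · refine (min_le_left _ _).trans ?_
      calc d s u ≤ d s x + d x u := tri _ _ _
        _ ≤ d s x + d x u + (w + d y t + d t y + w) := le_self_add
        _ = _ := by ring
    · refine (min_le_right _ _).trans ((min_le_right _ _).trans ?_)
      calc d s y + w + d x u ≤ d s y + w + d x u + (d x t + d t y + w) := le_self_add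
        _ = _ := by ring

variable [Fintype V]

/-- The number of points around `s`, weighted by `2 ^ (-distance)`. -/
noncomputable def crowd (d : V → V → ℕ∞) (s : V) : ℝ := ∑ t, decay (d s t)

/-- The binary logarithm of `crowd d s`, rounded up. -/
noncomputable def pot (d : V → V → ℕ∞) (s : V) : ℕ := Nat.clog 2 ⌈crowd d s⌉₊

theorem pot_le_iff {d : V → V → ℕ∞} {s : V} {j : ℕ} : pot d s ≤ j ↔ crowd d s ≤ 2 ^ j := by
  rw [pot, Nat.clog_le_iff_le_pow (by norm_num), Nat.ceil_le]
  norm_cast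

theorem crowd_le_two_pow_pot (d : V → V → ℕ∞) (s : V) : crowd d s ≤ 2 ^ pot d s :=
  pot_le_iff.1 le_rfl

theorem IsExtMetric.one_le_crowd {d : V → V → ℕ∞} (hd : IsExtMetric d) (s : V) :
    1 ≤ crowd d s := by
  have := Finset.single_le_sum (f := fun t => decay (d s t)) (fun t _ => decay_nonneg _)
    (Finset.mem_univ s)
  simpa [crowd, hd.self] using this

theorem IsExtMetric.decay_mul_crowd_le {d : V → V → ℕ∞} (hd : IsExtMetric d) (s x : V) :
    decay (d s x) * crowd d s ≤ crowd d x := by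
  rw [crowd, Finset.mul_sum]
  refine Finset.sum_le_sum fun t _ => ?_
  rw [← decay_add, hd.symm s x]
  exact decay_anti (hd.triangle _ _ _)

/-- Moving by one unit changes the crowd by at most a factor 2, hence its logarithm by at most 1.
This Lipschitz property is what allows a hub at distance `pot`. -/
theorem IsExtMetric.pot_le {d : V → V → ℕ∞} (hd : IsExtMetric d) (s x : V) :
    (pot d s : ℕ∞) ≤ d s x + pot d x := by
  have h := hd.decay_mul_crowd_le s x
  induction hk : d s x using ENat.recTopCoe with
  | top => simp
  | coe k =>
    rw [hk, decay_coe] at h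
    norm_cast
    rw [pot_le_iff, pow_add]
    have h2 := h.trans (crowd_le_two_pow_pot d x)
    rw [one_div, inv_pow, inv_mul_le_iff₀ (by positivity)] at h2
    exact h2

theorem crowd_mono {d d' : V → V → ℕ∞} (h : ∀ s t, d' s t ≤ d s t) (s : V) :
    crowd d s ≤ crowd d' s :=
  Finset.sum_le_sum fun t _ => decay_anti (h s t)

theorem pot_mono {d d' : V → V → ℕ∞} (h : ∀ s t, d' s t ≤ d s t) (s : V) :
    pot d s ≤ pot d' s :=
  pot_le_iff.2 ((crowd_mono h s).trans (crowd_le_two_pow_pot d' s))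

theorem IsExtMetric.pot_le_crowd {d : V → V → ℕ∞} (hd : IsExtMetric d) (s : V) :
    (pot d s : ℝ) ≤ crowd d s := by
  rcases Nat.eq_zero_or_pos (pot d s) with h0 | h0
  · rw [h0]
    have := hd.one_le_crowd s
    push_cast
    linarith
  · obtain ⟨j, hj⟩ : ∃ j, pot d s = j + 1 := ⟨pot d s - 1, by omega⟩
    have h1 : ¬ crowd d s ≤ 2 ^ j := by
      rw [← pot_le_iff]
      omega
    have h2 : j + 1 ≤ 2 ^ j := Nat.lt_two_pow_self
    have h3 : ((j + 1 : ℕ) : ℝ) ≤ 2 ^ j := by exact_mod_cast h2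
    rw [hj]
    linarith

/-- The weight of the next edge between `x` and `y`. -/
noncomputable def weight (d : V → V → ℕ∞) (x y : V) : ℕ := max 1 (pot d x + pot d y)

/-- The answer of the adversary to a query. -/
noncomputable def answer (d : V → V → ℕ∞) (x y : V) : ℕ := (min (d x y) (weight d x y)).toNat

theorem coe_answer (d : V → V → ℕ∞) (x y : V) :
    (answer d x y : ℕ∞) = min (d x y) (weight d x y) :=
  ENat.natCast_toNat (ne_top_of_le_ne_top (ENat.natCast_ne_top _) (min_le_right _ _))

/-- The distances after the answer of the adversary to a query. -/
noncomputable def update (d : V → V → ℕ∞) (x y : V) : V → V → ℕ∞ := addEdge d (weight d x y) x y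

theorem IsExtMetric.update {d : V → V → ℕ∞} (hd : IsExtMetric d) (x y : V) :
    IsExtMetric (update d x y) := hd.addEdge (le_max_left _ _) x y

theorem update_le (d : V → V → ℕ∞) (x y s t : V) : update d x y s t ≤ d s t := min_le_left _ _

theorem IsExtMetric.update_apply_le {d : V → V → ℕ∞} (hd : IsExtMetric d) (x y : V) :
    MetricMedian.update d x y x y ≤ answer d x y := by
  rw [coe_answer]
  refine min_le_min le_rfl ((min_le_left _ _).trans ?_)
  simp [hd.self]

/-- The reason for the choice of the weight: the new edge is long enough to outweigh the crowds at
both of its ends. -/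
theorem IsExtMetric.decay_weight_le {d : V → V → ℕ∞} (hd : IsExtMetric d) (x y : V) :
    decay (weight d x y) * (crowd d x * crowd d y) ≤ 1 := by
  have hx := hd.one_le_crowd x
  have hy := hd.one_le_crowd y
  calc decay (weight d x y) * (crowd d x * crowd d y)
      ≤ decay ((pot d x + pot d y : ℕ) : ℕ∞) * (crowd d x * crowd d y) := by
        gcongr
        apply decay_anti
        exact_mod_cast le_max_right _ _
    _ ≤ decay ((pot d x + pot d y : ℕ) : ℕ∞) * (2 ^ pot d x * 2 ^ pot d y) := by
        have := decay_nonneg ((pot d x + pot d y : ℕ) : ℕ∞)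
        gcongr
        · exact crowd_le_two_pow_pot d x
        · exact crowd_le_two_pow_pot d y
    _ = 1 := by
        rw [decay_coe, ← pow_add, ← mul_pow]
        norm_num

/-- What s newly sees through the edge from x to y is the crowd of y, damped by 2^(-d(s,x)) and by
the weight; the choice of the weight turns the latter into 1 / crowd x. The other direction is
symmetric. -/
theorem IsExtMetric.crowd_update_le {d : V → V → ℕ∞} (hd : IsExtMetric d) (x y s : V) :
    crowd (MetricMedian.update d x y) s ≤
      crowd d s + decay (d s x) / crowd d x + decay (d s y) / crowd d y := by
  have hx := hd.one_le_crowd x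
  have hy := hd.one_le_crowd y
  have hw := hd.decay_weight_le x y
  have h1 : crowd (MetricMedian.update d x y) s ≤ crowd d s +
      (decay (d s x) * decay (weight d x y) * crowd d y +
        decay (d s y) * decay (weight d x y) * crowd d x) := by
    simp only [crowd, Finset.mul_sum, ← Finset.sum_add_distrib, ← decay_add]
    refine Finset.sum_le_sum fun t _ => ?_
    exact (decay_min_le _ _).trans (by gcongr; exact decay_min_le _ _)
  have h2 : decay (weight d x y) * crowd d y ≤ 1 / crowd d x := by
    rw [le_div_iff₀ (by linarith)]
    linarith
  have h3 : decay (weight d x y) * crowd d x ≤ 1 / crowd d y := by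
    rw [le_div_iff₀ (by linarith)]
    linarith
  have h4 := mul_le_mul_of_nonneg_left h2 (decay_nonneg (d s x))
  have h5 := mul_le_mul_of_nonneg_left h3 (decay_nonneg (d s y))
  rw [mul_one_div] at h4 h5
  linarith

/-- What the adversary maintains after `q` queries. -/
structure IsTame (d : V → V → ℕ∞) (q : ℕ) : Prop extends IsExtMetric d where
  sq_le : ∀ s, crowd d s ^ 2 ≤ 1 + 8 * q
  sum_le : ∑ s, crowd d s ≤ Fintype.card V + 2 * q
  touched : ∃ T : Finset V, T.card ≤ 2 * q ∧ ∀ s ∉ T, ∀ t, t ≠ s → d s t = ⊤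

/-- Each of the two terms added to crowd s is at most 1 / crowd s, because 2^(-d(s,x)) · crowd s ≤
crowd x. So the square grows by at most 2·2 + 2² = 8. Summed over s, each term is exactly 1, so the
total grows by at most 2. -/
theorem IsTame.update {d : V → V → ℕ∞} {q : ℕ} (hd : IsTame d q) (x y : V) :
    IsTame (MetricMedian.update d x y) (q + 1) where
  toIsExtMetric := hd.toIsExtMetric.update x y
  sq_le s := by
    have h := hd.crowd_update_le x y s
    have h0 := hd.one_le_crowd s
    have h0' := (hd.toIsExtMetric.update x y).one_le_crowd s
    have hx := hd.one_le_crowd x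
    have hy := hd.one_le_crowd y
    have h1 : decay (d s x) / crowd d x * crowd d s ≤ 1 := by
      rw [div_mul_eq_mul_div, div_le_one (by linarith)]
      exact hd.decay_mul_crowd_le s x
    have h2 : decay (d s y) / crowd d y * crowd d s ≤ 1 := by
      rw [div_mul_eq_mul_div, div_le_one (by linarith)]
      exact hd.decay_mul_crowd_le s y
    have h3 := hd.sq_le s
    set e := decay (d s x) / crowd d x + decay (d s y) / crowd d y with he
    have he0 : 0 ≤ e := by
      have := decay_nonneg (d s x)
      have := decay_nonneg (d s y)
      positivity
    have he1 : e * crowd d s ≤ 2 := by rw [he, add_mul]; linarith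
    have he2 : e ≤ 2 := by nlinarith
    push_cast
    calc crowd (MetricMedian.update d x y) s ^ 2 ≤ (crowd d s + e) ^ 2 := by
          gcongr
          linarith
      _ = crowd d s ^ 2 + 2 * (e * crowd d s) + e ^ 2 := by ring
      _ ≤ (1 + 8 * q) + 2 * 2 + 2 ^ 2 := by gcongr
      _ = _ := by ring
  sum_le := by
    have hx := hd.one_le_crowd x
    have hy := hd.one_le_crowd y
    have key : ∀ z, 1 ≤ crowd d z → ∑ s, decay (d s z) / crowd d z = 1 := fun z hz => by
      rw [← Finset.sum_div]
      simp only [fun s => hd.symm s z]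
      exact div_self (by rw [← crowd]; linarith)
    calc ∑ s, crowd (MetricMedian.update d x y) s
        ≤ ∑ s, (crowd d s + decay (d s x) / crowd d x + decay (d s y) / crowd d y) :=
          Finset.sum_le_sum fun s _ => hd.crowd_update_le x y s
      _ = ∑ s, crowd d s + 1 + 1 := by
          rw [Finset.sum_add_distrib, Finset.sum_add_distrib, key x hx, key y hy]
      _ ≤ _ := by
          have := hd.sum_le
          push_cast
          linarith
  touched := by
    classical
    obtain ⟨T, hT, hd'⟩ := hd.touched
    refine ⟨insert x (insert y T), ?_, fun s hs t ht => ?_⟩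
    · have := Finset.card_insert_le x (insert y T)
      have := Finset.card_insert_le y T
      omega
    · simp only [Finset.mem_insert, not_or] at hs
      have := hd' s hs.2.2
      simp [MetricMedian.update, MetricMedian.addEdge, this t ht, this x (Ne.symm hs.1),
        this y (Ne.symm hs.2.1)]

/-- `D` extends the answers of the adversary. -/
structure IsCompatible (D : V → V → ℕ) (d : V → V → ℕ∞) : Prop where
  le : ∀ s t, (D s t : ℕ∞) ≤ d s t
  ge : ∀ s t, s ≠ t → 1 ≤ pot d s → 1 ≤ pot d t → min (d s t) (pot d s + pot d t : ℕ) ≤ D s t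

theorem IsExtMetric.one_le_pot {d : V → V → ℕ∞} (hd : IsExtMetric d) {s t : V} (hst : s ≠ t)
    (h : d s t ≠ ⊤) : 1 ≤ pot d s := by
  classical
  by_contra! h0
  have h1 : crowd d s ≤ 1 := by simpa using pot_le_iff.1 (Nat.lt_one_iff.1 h0).le
  have h2 := Finset.add_le_sum (f := fun t => decay (d s t)) (fun t _ => decay_nonneg _)
    (Finset.mem_univ s) (Finset.mem_univ t) hst
  obtain ⟨k, hk⟩ := ENat.ne_top_iff_exists.1 h
  simp only [hd.self, decay_zero, ← hk, decay_coe] at h2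
  rw [← crowd] at h2
  have : (0 : ℝ) < (1 / 2) ^ k := by positivity
  linarith

/-- Compatibility with the final state passes back to all earlier ones. A path over the new edge has
length at least pot s + pot t, as its weight is at least pot x + pot y and `pot` is 1-Lipschitz;
besides, potentials only grow. -/
theorem IsCompatible.of_update {D : V → V → ℕ} {d : V → V → ℕ∞} (hd : IsExtMetric d) {x y : V}
    (h : IsCompatible D (update d x y)) : IsCompatible D d where
  le s t := (h.le s t).trans (update_le d x y s t)
  ge s t hst hs ht := by
    have hs' := pot_mono (update_le d x y) s
    have ht' := pot_mono (update_le d x y) t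
    refine le_trans (le_min (le_min (min_le_left _ _) (min_le_of_right_le ?_)) ?_)
      (h.ge s t hst (hs.trans hs') (ht.trans ht'))
    · have key : ∀ u v, ((pot d s + pot d t : ℕ) : ℕ∞) ≤
          d s u + (pot d u + pot d v : ℕ) + d v t := fun u v => by
        push_cast
        calc (pot d s : ℕ∞) + pot d t ≤ (d s u + pot d u) + (d t v + pot d v) :=
              add_le_add (hd.pot_le s u) (hd.pot_le t v)
          _ = _ := by rw [hd.symm t v]; ring
      refine le_min ((key x y).trans ?_) ((key y x).trans ?_)
      · gcongr
        exact le_max_right _ _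
      · gcongr
        rw [add_comm]
        exact le_max_right _ _
    · refine min_le_of_right_le ?_
      exact_mod_cast add_le_add hs' ht'

theorem IsCompatible.eq_answer {D : V → V → ℕ} {d : V → V → ℕ∞} (hd : IsExtMetric d) {x y : V}
    (h : IsCompatible D (update d x y)) : D x y = answer d x y := by
  have hle : D x y ≤ answer d x y := by
    exact_mod_cast (h.le x y).trans (hd.update_apply_le x y)
  refine le_antisymm hle ?_
  by_cases hxy : x = y
  · subst hxy
    have : (answer d x x : ℕ∞) = 0 := by simp [coe_answer, hd.self]
    have : answer d x x = 0 := by exact_mod_cast this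
    omega
  have hd' := hd.update x y
  have hx : 1 ≤ pot (update d x y) x := hd'.one_le_pot hxy
    (ne_top_of_le_ne_top (ENat.natCast_ne_top _) (hd.update_apply_le x y))
  have hy : 1 ≤ pot (update d x y) y := hd'.one_le_pot (Ne.symm hxy)
    (by rw [hd'.symm]; exact ne_top_of_le_ne_top (ENat.natCast_ne_top _) (hd.update_apply_le x y))
  have := h.ge x y hxy hx hy
  have hw : answer d x y ≤ pot (update d x y) x + pot (update d x y) y := by
    have h1 : answer d x y ≤ weight d x y := by
      have := (coe_answer d x y).le.trans (min_le_right _ _)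
      exact_mod_cast this
    -- The lower bound 1 in the weight does no harm: after the update both ends have a positive
    -- potential.
    refine h1.trans (max_le (by omega) (add_le_add ?_ ?_)) <;>
    exact pot_mono (update_le d x y) _
  have h2 : (answer d x y : ℕ∞) ≤ D x y := by
    refine le_trans (le_min ?_ ?_) this
    · rw [coe_answer]
      refine le_min (min_le_left _ _) ?_
      refine le_min ?_ ?_
      · simp [hd.self]
      · by_cases h0 : d x y = ⊤
        · rw [hd.symm x y] at h0
          simp [hd.symm x y, h0]
        · refine min_le_of_right_le ?_
          calc (weight d x y : ℕ∞) ≤ weight d x y + (d x y + d x y) := le_self_add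
            _ = _ := by ring
    · exact_mod_cast hw
  exact_mod_cast h2

end MetricMedian

/-! ### Metrics with a hub that realize the answers -/

namespace MetricMedian

section Pseudo

variable {V : Type*}

/-- A pseudometric with values in the natural numbers. -/
structure IsPseudo (D : V → V → ℕ) : Prop where
  self : ∀ s, D s s = 0
  symm : ∀ s t, D s t = D t s
  triangle : ∀ s t u, D s u ≤ D s t + D t u

open Classical in
/-- The metric that arises from a pseudometric with values in the natural numbers if the
distance `0` of different points is replaced by `δ`. -/
noncomputable abbrev IsPseudo.toMetric {D : V → V → ℕ} (hD : IsPseudo D) {δ : ℝ} (h0 : 0 < δ)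
    (h1 : δ ≤ 1) : MetricSpace V where
  dist s t := if s = t then 0 else if D s t = 0 then δ else D s t
  dist_self s := by simp
  dist_comm s t := by simp only [eq_comm (a := s) (b := t), hD.symm s t]
  dist_triangle s t u := by
    by_cases hst : s = t
    · subst hst; simp
    by_cases htu : t = u
    · subst htu; simp
    have key : ∀ v w, (D v w : ℝ) ≤ (if D v w = 0 then δ else (D v w : ℝ)) ∧
        δ ≤ (if D v w = 0 then δ else (D v w : ℝ)) := fun v w => by
      split_ifs with h
      · simp [h, h0.le]
      · refine ⟨le_rfl, h1.trans ?_⟩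
        exact_mod_cast Nat.one_le_iff_ne_zero.2 h
    rw [if_neg hst, if_neg htu]
    have k1 := key s t
    have k2 := key t u
    split_ifs at k1 k2 ⊢ <;>
    first
    | linarith
    | (have h : (D s u : ℝ) ≤ D s t + D t u := by exact_mod_cast hD.triangle s t u
       linarith)
  eq_of_dist_eq_zero {s t} h := by
    by_contra hst
    simp only [hst, if_false] at h
    split_ifs at h with h'
    · exact h0.ne' h
    · exact h' (by exact_mod_cast h)

open Classical in
theorem IsPseudo.toMetric_dist_eq_ite {D : V → V → ℕ} (hD : IsPseudo D) {δ : ℝ} (h0 : 0 < δ)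
    (h1 : δ ≤ 1) (s t : V) : (hD.toMetric h0 h1).dist s t =
      if s = t then 0 else if D s t = 0 then δ else (D s t : ℝ) := rfl

theorem IsPseudo.toMetric_dist {D : V → V → ℕ} (hD : IsPseudo D) {δ : ℝ} (h0 : 0 < δ)
    (h1 : δ ≤ 1) {s t : V} (h : s = t ∨ D s t ≠ 0) : (hD.toMetric h0 h1).dist s t = D s t := by
  rcases h with rfl | h
  · simp [hD.self]
  · have hst : s ≠ t := by
      rintro rfl
      exact h (hD.self s)
    simp [hD.toMetric_dist_eq_ite, h, hst]

theorem IsPseudo.le_toMetric_dist {D : V → V → ℕ} (hD : IsPseudo D) {δ : ℝ} (h0 : 0 < δ)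
    (h1 : δ ≤ 1) (s t : V) : (D s t : ℝ) ≤ (hD.toMetric h0 h1).dist s t := by
  by_cases h : s = t ∨ D s t ≠ 0
  · rw [hD.toMetric_dist h0 h1 h]
  · push Not at h
    simp [hD.toMetric_dist_eq_ite, h.1, h.2, h0.le]

theorem IsPseudo.toMetric_dist_le {D : V → V → ℕ} (hD : IsPseudo D) {δ : ℝ} (h0 : 0 < δ)
    (h1 : δ ≤ 1) (s t : V) : (hD.toMetric h0 h1).dist s t ≤ D s t + δ := by
  by_cases h : s = t ∨ D s t ≠ 0
  · rw [hD.toMetric_dist h0 h1 h]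
    linarith
  · push Not at h
    simp [hD.toMetric_dist_eq_ite, h.1, h.2]

/-- The distances after a hub is added at distance `l s` from every point `s`. -/
noncomputable def hubDist (d : V → V → ℕ∞) (l : V → ℕ) (s t : V) : ℕ :=
  (min (d s t) (l s + l t : ℕ)).toNat

theorem coe_hubDist (d : V → V → ℕ∞) (l : V → ℕ) (s t : V) :
    (hubDist d l s t : ℕ∞) = min (d s t) (l s + l t : ℕ) :=
  ENat.natCast_toNat (ne_top_of_le_ne_top (ENat.natCast_ne_top _) (min_le_right _ _))

theorem hubDist_le (d : V → V → ℕ∞) (l : V → ℕ) (s t : V) : hubDist d l s t ≤ l s + l t := by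
  have := (coe_hubDist d l s t).le.trans (min_le_right _ _)
  exact_mod_cast this

/-- A shortest path either avoids the hub or passes it once; a detour before or after the hub is
absorbed because l is 1-Lipschitz. -/
theorem isPseudo_hubDist {d : V → V → ℕ∞} (hd : IsExtMetric d) {l : V → ℕ}
    (hl : ∀ s t, (l s : ℕ∞) ≤ d s t + l t) : IsPseudo (hubDist d l) where
  self s := by
    have : (hubDist d l s s : ℕ∞) = 0 := by simp [coe_hubDist, hd.self]
    exact_mod_cast this
  symm s t := by rw [hubDist, hubDist, hd.symm, add_comm]
  triangle s t u := by
    have : (hubDist d l s u : ℕ∞) ≤ hubDist d l s t + hubDist d l t u := by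
      simp only [coe_hubDist, min_add, add_min, le_min_iff]
      push_cast
      refine ⟨⟨(min_le_left _ _).trans (hd.triangle s t u), ?_⟩, ?_, ?_⟩
      · refine (min_le_right _ _).trans ?_
        calc (l s : ℕ∞) + l u ≤ l s + (d u t + l t) := by gcongr; exact hl u t
          _ = _ := by rw [hd.symm u t]; ring
      · refine (min_le_right _ _).trans ?_
        calc (l s : ℕ∞) + l u ≤ d s t + l t + l u := by gcongr; exact hl s t
          _ = _ := by ring
      · refine (min_le_right _ _).trans ?_
        calc (l s : ℕ∞) + l u ≤ l s + l u + (l t + l t) := le_self_add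
          _ = _ := by ring
    exact_mod_cast this

/-- This leaves l free until the output is known, subject only to l ≥ pot and the Lipschitz
condition. -/
theorem isCompatible_hubDist [Fintype V] {d : V → V → ℕ∞} {l : V → ℕ}
    (hl : ∀ s, pot d s ≤ l s) : IsCompatible (hubDist d l) d where
  le s t := (coe_hubDist d l s t).le.trans (min_le_left _ _)
  ge s t _ _ _ := by
    rw [coe_hubDist]
    refine min_le_min le_rfl ?_
    exact_mod_cast add_le_add (hl s) (hl t)

end Pseudo

/-! ### Making the output far from the hub -/

section Level

variable {V : Type*} [Fintype V]

/-- The distance of `s` from the hub if the point `p` has to be at distance at least `r`. -/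
noncomputable def level (d : V → V → ℕ∞) (p : V) (r : ℕ) (s : V) : ℕ :=
  max (pot d s) (r - d p s).toNat

theorem coe_toNat_tsub (r : ℕ) (a : ℕ∞) : (((r : ℕ∞) - a).toNat : ℕ∞) = r - a :=
  ENat.natCast_toNat (ne_top_of_le_ne_top (ENat.natCast_ne_top r) tsub_le_self)

theorem level_lipschitz {d : V → V → ℕ∞} (hd : IsExtMetric d) (p : V) (r : ℕ) (s t : V) :
    (level d p r s : ℕ∞) ≤ d s t + level d p r t := by
  have h : ((max (pot d s) (r - d p s).toNat : ℕ) : ℕ∞) =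
      max (pot d s : ℕ∞) (((r : ℕ∞) - d p s).toNat : ℕ∞) := rfl
  rw [level, h]
  refine max_le ((hd.pot_le s t).trans ?_) ?_
  · gcongr
    exact le_max_left _ _
  · have h2 : (((r : ℕ∞) - d p t).toNat : ℕ∞) ≤ level d p r t := by
      exact_mod_cast le_max_right _ _
    rw [coe_toNat_tsub] at h2 ⊢
    rw [tsub_le_iff_right]
    calc (r : ℕ∞) ≤ (r - d p t) + d p t := le_tsub_add
      _ ≤ level d p r t + (d p s + d s t) := add_le_add h2 (hd.triangle _ _ _)
      _ = _ := by ring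

/-- The left side vanishes for a ≥ r, and for a ≤ r the factor 2^(r-a) is at least 1. In this form
the sum over all points is bounded by the crowd of p. -/
theorem toNat_tsub_le (r : ℕ) (a : ℕ∞) :
    (((r : ℕ∞) - a).toNat : ℝ) ≤ r * 2 ^ r * decay a := by
  induction a using ENat.recTopCoe with
  | top => simp
  | coe k =>
    rw [show (r : ℕ∞) - k = (r - k : ℕ) by push_cast; rfl, ENat.toNat_natCast, decay_coe]
    rcases le_total r k with h | h
    · rw [Nat.sub_eq_zero_of_le h]
      push_cast
      positivity
    · have h1 : ((r - k : ℕ) : ℝ) ≤ r := by exact_mod_cast Nat.sub_le r k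
      have h2 : (1 : ℝ) ≤ 2 ^ r * (1 / 2) ^ k := by
        rw [one_div, inv_pow, ← div_eq_mul_inv, le_div_iff₀ (by positivity), one_mul]
        exact pow_le_pow_right₀ (by norm_num) h
      have h3 : (0 : ℝ) ≤ r := by positivity
      calc ((r - k : ℕ) : ℝ) ≤ r * 1 := by linarith
        _ ≤ r * (2 ^ r * (1 / 2) ^ k) := by gcongr
        _ = _ := by ring

theorem IsTame.sum_level_le {d : V → V → ℕ∞} {q : ℕ} (hd : IsTame d q) (p : V) (r : ℕ) :
    (∑ s, level d p r s : ℝ) ≤ 4 * q + r * 2 ^ r * crowd d p := by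
  classical
  obtain ⟨T, hT, htop⟩ := hd.touched
  -- Untouched points have crowd 1 and potential 0. Summing leaves the total excess, at most 2q,
  -- plus the number of touched points, at most 2q.
  have h1 : ∀ s, (pot d s : ℝ) ≤ crowd d s - 1 + if s ∈ T then 1 else 0 := fun s => by
    split_ifs with hs
    · linarith [hd.pot_le_crowd s]
    · have hc : crowd d s = 1 := by
        rw [crowd, Finset.sum_eq_single s]
        · simp [hd.self]
        · intro t _ ht
          simp [htop s hs t ht]
        · simp
      have : pot d s ≤ 0 := by rw [pot_le_iff, hc]; simp
      simp [Nat.le_zero.1 this, hc]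
  have h2 : ∀ s, (level d p r s : ℝ) ≤
      (crowd d s - 1 + if s ∈ T then 1 else 0) + r * 2 ^ r * decay (d p s) := fun s => by
    have : level d p r s ≤ pot d s + (r - d p s).toNat := max_le (by omega) (by omega)
    have h3 : (level d p r s : ℝ) ≤ pot d s + (((r : ℕ∞) - d p s).toNat : ℝ) := by
      exact_mod_cast this
    linarith [h1 s, toNat_tsub_le r (d p s)]
  refine (Finset.sum_le_sum fun s _ => h2 s).trans ?_
  rw [Finset.sum_add_distrib, Finset.sum_add_distrib, Finset.sum_sub_distrib, ← Finset.mul_sum,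
    ← crowd]
  have h4 := hd.sum_le
  have h5 : (T.card : ℝ) ≤ 2 * q := by exact_mod_cast hT
  simp only [Finset.sum_ite_mem, Finset.univ_inter, Finset.sum_const, Finset.card_univ,
    nsmul_eq_mul, mul_one]
  linarith

/-- A slowly growing lower bound for `n / q`. -/
def sparsity (n q : ℕ) : ℕ := max 1 (min (n / (q + 1)) (2 ^ (Nat.log 2 n / 8)))

/-- The 7 is 4 + 3. The term 4q costs 4n because f(q+1) ≤ n. The other term is at most 8^r · c since
f, r ≤ 2^r, and this is at most 3n since 64^r ≤ n and c² ≤ 9n; the division by 8 in r gives room for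
64^r ≤ n. -/
theorem sparsity_mul_le {n q : ℕ} (hn : q + 1 ≤ n) {c S : ℝ} (hc0 : 0 ≤ c)
    (hc : c ^ 2 ≤ 1 + 8 * q)
    (hS : S ≤ 4 * q + (Nat.log 2 n / 8 : ℕ) * 2 ^ (Nat.log 2 n / 8) * c) :
    sparsity n q * S ≤ 7 * n := by
  set r := Nat.log 2 n / 8 with hr
  have hf1 : sparsity n q * (q + 1) ≤ n := by
    rw [sparsity, max_mul, one_mul]
    exact max_le hn ((Nat.mul_le_mul_right _ (min_le_left _ _)).trans (Nat.div_mul_le_self _ _))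
  have hf2 : sparsity n q ≤ 2 ^ r := max_le Nat.one_le_two_pow (min_le_right _ _)
  have hr2 : r ≤ 2 ^ r := Nat.lt_two_pow_self.le
  have h64 : 64 ^ r ≤ n := by
    calc 64 ^ r = 2 ^ (6 * r) := by rw [pow_mul]; norm_num
      _ ≤ 2 ^ Nat.log 2 n := Nat.pow_le_pow_right (by norm_num) (by omega)
      _ ≤ n := Nat.pow_log_le_self 2 (by omega)
  have h64' : (64 : ℝ) ^ r ≤ n := by exact_mod_cast h64
  have hn' : (q : ℝ) + 1 ≤ n := by exact_mod_cast hn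
  have hq0 : (0 : ℝ) ≤ q := by positivity
  have h3 : (8 : ℝ) ^ r * c ≤ 3 * n := by
    refine abs_le_of_sq_le_sq' ?_ (by positivity) |>.2
    have h8 : ((8 : ℝ) ^ r) ^ 2 = 64 ^ r := by
      rw [← pow_mul, mul_comm r 2, pow_mul]
      norm_num
    have hc9 : c ^ 2 ≤ 9 * n := by linarith
    rw [mul_pow, h8]
    calc (64 : ℝ) ^ r * c ^ 2 ≤ n * (9 * n) := by gcongr
      _ = (3 * (n : ℝ)) ^ 2 := by ring
  have hf1' : (sparsity n q : ℝ) * (q + 1) ≤ n := by exact_mod_cast hf1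
  have hf2' : (sparsity n q : ℝ) ≤ 2 ^ r := by exact_mod_cast hf2
  have hr2' : (r : ℝ) ≤ 2 ^ r := by exact_mod_cast hr2
  have hf0 : (0 : ℝ) ≤ sparsity n q := by positivity
  calc (sparsity n q : ℝ) * S ≤ sparsity n q * (4 * q + r * 2 ^ r * c) := by gcongr
    _ = 4 * (sparsity n q * q) + sparsity n q * r * 2 ^ r * c := by ring
    _ ≤ 4 * n + 2 ^ r * 2 ^ r * 2 ^ r * c := by
        gcongr
        linarith
    _ = 4 * n + 8 ^ r * c := by
        rw [← mul_pow, ← mul_pow]; norm_num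
    _ ≤ _ := by linarith

/-- `p` is far from most points but some point is not. -/
def IsBadChoice {n : ℕ} (D : Fin n → Fin n → ℕ) (p : Fin n) (q : ℕ) (z : Fin n) : Prop :=
  n * (Nat.log 2 n / 8) ≤ ∑ y, D p y + ∑ y, D z y ∧ sparsity n q * ∑ y, D z y ≤ 7 * n

theorem IsTame.exists_isBadChoice {n q : ℕ} {d : Fin n → Fin n → ℕ∞} (hd : IsTame d q)
    (hn : 2 * q + 1 < n) (p : Fin n) :
    ∃ z, IsBadChoice (hubDist d (level d p (Nat.log 2 n / 8))) p q z := by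
  classical
  obtain ⟨T, hT, htop⟩ := hd.touched
  -- At most 2q points are touched, so some point other than p is not; it lies at the hub.
  obtain ⟨z, hz⟩ : ∃ z, z ∉ insert p T := by
    by_contra! h
    have h1 := Finset.card_le_card fun z (_ : z ∈ Finset.univ) => h z
    have h2 := Finset.card_insert_le p T
    rw [Finset.card_univ, Fintype.card_fin] at h1
    omega
  simp only [Finset.mem_insert, not_or] at hz
  set r := Nat.log 2 n / 8 with hr
  set l := level d p r with hl
  have hdz : d p z = ⊤ := by rw [hd.symm]; exact htop z hz.2 p (Ne.symm hz.1)
  have hlz : l z = 0 := by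
    have hc : crowd d z = 1 := by
      rw [crowd, Finset.sum_eq_single z]
      · simp [hd.self]
      · intro t _ ht
        simp [htop z hz.2 t ht]
      · simp
    have : pot d z ≤ 0 := by rw [pot_le_iff, hc]; simp
    simp [hl, level, hdz, Nat.le_zero.1 this]
  have hlp : r ≤ l p := by simp [hl, level, hd.self]
  have hD := isPseudo_hubDist hd.toIsExtMetric (l := l) (level_lipschitz hd.toIsExtMetric p r)
  have hpz : hubDist d l p z = l p := by
    have : (hubDist d l p z : ℕ∞) = l p := by rw [coe_hubDist, hdz, hlz]; simp
    exact_mod_cast this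
  refine ⟨z, ?_, ?_⟩
  · rw [← Finset.sum_add_distrib]
    calc n * r = ∑ _y : Fin n, r := by simp
      _ ≤ _ := Finset.sum_le_sum fun y _ => by
        have := hD.triangle p y z
        rw [hD.symm y z, hpz] at this
        omega
  · have h1 : ∑ y, hubDist d l z y ≤ ∑ y, l y :=
      Finset.sum_le_sum fun y _ => by
        have := hubDist_le d l z y
        omega
    have h2 : (sparsity n q : ℝ) * (∑ y, l y : ℕ) ≤ 7 * n := by
      refine sparsity_mul_le (by omega) ?_ (hd.sq_le p) ?_
      · linarith [hd.one_le_crowd p]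
      · push_cast
        exact hd.sum_level_le p r
    have h3 : sparsity n q * ∑ y, l y ≤ 7 * n := by exact_mod_cast h2
    exact (Nat.mul_le_mul_left _ h1).trans h3

end Level

end MetricMedian

/-! ### Running an algorithm against the adversary -/

namespace MetricMedian

namespace Algorithm

open Classical in
/-- `A.ValidRun D h a`: when the queries are answered by `D`, the algorithm arrives at the history
`h` with the answers `a`, and different queried points have a positive distance. -/
inductive ValidRun (A : Algorithm) {n : ℕ} (D : Fin n → Fin n → ℕ) : List Bool → List ℕ → Prop
  | start : ValidRun A D [] []
  | query {h : List Bool} {a : List ℕ} (x y : Fin n) :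
      ValidRun A D h a → A.next n h = Instr.query x y → (x = y ∨ D x y ≠ 0) →
      ValidRun A D (h ++ [true]) (a ++ [D x y])
  | test {h : List Bool} {a : List ℕ} (P : RealPoly) :
      ValidRun A D h a → A.next n h = Instr.test P →
      ValidRun A D (h ++ [decide (0 ≤ P.eval (a.map (Nat.cast : ℕ → ℝ)))]) a

theorem ValidRun.reaches {A : Algorithm} {n : ℕ} {D : Fin n → Fin n → ℕ} (hD : IsPseudo D)
    {δ : ℝ} (h0 : 0 < δ) (h1 : δ ≤ 1) {h : List Bool} {a : List ℕ} (H : A.ValidRun D h a) :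
    A.Reaches (hD.toMetric h0 h1) h (a.map (Nat.cast : ℕ → ℝ)) := by
  induction H with
  | start => exact .start
  | query x y H hn hxy ih =>
    rw [List.map_append, List.map_singleton, ← hD.toMetric_dist h0 h1 hxy]
    exact .query x y ih hn
  | test P H hn ih => exact .test P ih hn

/-- A point that a `β`-approximate algorithm outputs for `D` is a `β`-approximate `1`-median
of `D`. -/
theorem IsApproxAt.sum_le {A : Algorithm} {n : ℕ} {β : ℝ} (hβ : A.IsApproxAt n β) (h1 : 0 ≤ β)
    {D : Fin n → Fin n → ℕ} (hD : IsPseudo D) {h : List Bool} {a : List ℕ}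
    (H : A.ValidRun D h a) {p : Fin n} (hp : A.next n h = Instr.output p) (z : Fin n) :
    (∑ y, D p y : ℝ) ≤ β * ∑ y, (D z y : ℝ) := by
  -- Queried pairs of different points have a positive distance, so replacing zeros by δ does not
  -- affect the run: the output p is the same for all δ, which may then tend to 0.
  have key : ∀ δ : ℝ, 0 < δ → δ ≤ 1 →
      (∑ y, D p y : ℝ) ≤ β * (∑ y, (D z y : ℝ) + n * δ) := fun δ hδ0 hδ1 => by
    obtain ⟨p', k, hp', hm⟩ := hβ (hD.toMetric hδ0 hδ1)
    obtain ⟨rfl, -⟩ := hp'.unique ⟨h, _, H.reaches hD hδ0 hδ1, hp, rfl⟩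
    calc (∑ y, D p' y : ℝ) ≤ ∑ y, (hD.toMetric hδ0 hδ1).dist p' y :=
          Finset.sum_le_sum fun y _ => hD.le_toMetric_dist hδ0 hδ1 p' y
      _ ≤ β * ∑ y, (hD.toMetric hδ0 hδ1).dist z y := hm z
      _ ≤ β * ∑ y, ((D z y : ℝ) + δ) := by
          gcongr with y
          exact hD.toMetric_dist_le hδ0 hδ1 z y
      _ = _ := by simp [Finset.sum_add_distrib]
  have hlim : Tendsto (fun δ : ℝ => β * (∑ y, (D z y : ℝ) + n * δ)) (nhdsWithin 0 (Set.Ioi 0))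
      (nhds (β * ∑ y, (D z y : ℝ))) := by
    have : Continuous fun δ : ℝ => β * (∑ y, (D z y : ℝ) + n * δ) := by fun_prop
    simpa using (this.tendsto 0).mono_left nhdsWithin_le_nhds
  refine ge_of_tendsto hlim ?_
  filter_upwards [Ioo_mem_nhdsGT (zero_lt_one' ℝ)] with δ hδ
  exact key δ hδ.1 hδ.2.le

/-- A bad choice is a lower bound for the approximation ratio. -/
theorem IsApproxAt.sparsity_mul_le {A : Algorithm} {n : ℕ} (hn : 1 ≤ n) {β : ℝ}
    (hβ : A.IsApproxAt n β) (h1 : 0 ≤ β) {D : Fin n → Fin n → ℕ} (hD : IsPseudo D)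
    {h : List Bool} {a : List ℕ} (H : A.ValidRun D h a) {p : Fin n}
    (hp : A.next n h = Instr.output p) {q : ℕ} {z : Fin n} (hz : IsBadChoice D p q z) :
    (sparsity n q : ℝ) * (Nat.log 2 n / 8 : ℕ) ≤ 7 * (β + 1) := by
  have h2 := hβ.sum_le h1 hD H hp z
  have h3 : (n : ℝ) * (Nat.log 2 n / 8 : ℕ) ≤ ∑ y, (D p y : ℝ) + ∑ y, (D z y : ℝ) := by
    exact_mod_cast hz.1
  have h4 : (sparsity n q : ℝ) * ∑ y, (D z y : ℝ) ≤ 7 * n := by exact_mod_cast hz.2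
  have hn' : (0 : ℝ) < n := by exact_mod_cast hn
  have hs : (0 : ℝ) ≤ sparsity n q := by positivity
  refine le_of_mul_le_mul_left ?_ hn'
  calc (n : ℝ) * (sparsity n q * (Nat.log 2 n / 8 : ℕ))
      = sparsity n q * (n * (Nat.log 2 n / 8 : ℕ)) := by ring
    _ ≤ sparsity n q * ((β + 1) * ∑ y, (D z y : ℝ)) :=
        mul_le_mul_of_nonneg_left (by linarith) hs
    _ = (β + 1) * (sparsity n q * ∑ y, (D z y : ℝ)) := by ring
    _ ≤ (β + 1) * (7 * n) := by gcongr
    _ = _ := by ring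

open Classical in
/-- `A.AdvRun h a d`: against the adversary, the algorithm arrives at the history `h` with the
answers `a`, and the adversary has committed itself to the distances `d`. -/
inductive AdvRun (A : Algorithm) {n : ℕ} :
    List Bool → List ℕ → (Fin n → Fin n → ℕ∞) → Prop
  | start : AdvRun A [] [] (fun s t => if s = t then 0 else ⊤)
  | query {h : List Bool} {a : List ℕ} {d : Fin n → Fin n → ℕ∞} (x y : Fin n) :
      AdvRun A h a d → A.next n h = Instr.query x y →
      AdvRun A (h ++ [true]) (a ++ [answer d x y]) (update d x y)
  | test {h : List Bool} {a : List ℕ} {d : Fin n → Fin n → ℕ∞} (P : RealPoly) :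
      AdvRun A h a d → A.next n h = Instr.test P →
      AdvRun A (h ++ [decide (0 ≤ P.eval (a.map (Nat.cast : ℕ → ℝ)))]) a d

theorem AdvRun.isTame {A : Algorithm} {n : ℕ} {h : List Bool} {a : List ℕ}
    {d : Fin n → Fin n → ℕ∞} (H : A.AdvRun h a d) : IsTame d a.length := by
  induction H with
  | start =>
    have hc : ∀ s : Fin n, crowd (fun s t : Fin n => if s = t then (0 : ℕ∞) else ⊤) s = 1 :=
      fun s => by
        rw [crowd, Finset.sum_eq_single s]
        · simp
        · intro t _ ht
          simp [ht.symm]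
        · simp
    refine ⟨⟨fun s t => ?_, fun s t => ?_, fun s t u => ?_⟩, fun s => ?_, ?_, ∅, by simp, ?_⟩
    · by_cases h : s = t <;> simp [h]
    · simp only [eq_comm]
    · by_cases h : s = t
      · simp [h]
      · simp [h]
    · rw [hc]
      simp
    · simp [hc]
    · intro s _ t ht
      simp [ht.symm]
  | query x y H hn ih => simpa using ih.update x y
  | test P H hn ih => exact ih

/-- Compatibility passes back through all updates, so D gives the answer of the adversary at every
query. Answers for different points are positive because weights are. -/
theorem AdvRun.validRun {A : Algorithm} {n : ℕ} {h : List Bool} {a : List ℕ}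
    {d : Fin n → Fin n → ℕ∞} (H : A.AdvRun h a d) {D : Fin n → Fin n → ℕ}
    (hD : IsCompatible D d) : A.ValidRun D h a := by
  induction H with
  | start => exact .start
  | @query _ _ d x y H hn ih =>
    have hd := H.isTame.toIsExtMetric
    have h1 := hD.eq_answer hd
    rw [← h1]
    refine .query x y (ih (hD.of_update hd)) hn ?_
    by_contra! h2
    have h3 : (answer d x y : ℕ∞) = 0 := by rw [← h1, h2.2]; simp
    rw [coe_answer] at h3
    rcases min_choice (α := ℕ∞) _ _ with h4 | h4 <;> rw [h4] at h3
    · exact h2.1 ((hd.eq_zero_iff x y).1 h3)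
    · have : weight d x y = 0 := by exact_mod_cast h3
      simp [weight] at this
  | test P H hn ih => exact .test P (ih hD) hn

/-- Against the adversary, the algorithm halts after at most `q` queries. -/
theorem exists_advRun_output {A : Algorithm} {n q : ℕ}
    (hA : ∀ m : MetricSpace (Fin n), ∃ p k, A.HaltsWith m p k ∧ k ≤ q) :
    ∃ (h : List Bool) (a : List ℕ) (d : Fin n → Fin n → ℕ∞) (p : Fin n),
      A.AdvRun h a d ∧ A.next n h = Instr.output p := by
  classical
  have real : ∀ {h a} {d : Fin n → Fin n → ℕ∞}, A.AdvRun h a d →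
      ∃ m : MetricSpace (Fin n), A.Reaches m h (a.map (Nat.cast : ℕ → ℝ)) := fun {h a d} H => by
    have hd := H.isTame.toIsExtMetric
    have hD := isPseudo_hubDist hd (l := pot d) hd.pot_le
    exact ⟨hD.toMetric one_pos le_rfl,
      (H.validRun (isCompatible_hubDist fun s => le_rfl)).reaches hD one_pos le_rfl⟩
  have bdd : ∀ {h a} {d : Fin n → Fin n → ℕ∞}, A.AdvRun h a d → a.length ≤ q := fun H => by
    obtain ⟨m, hm⟩ := real H
    obtain ⟨p, k, hp, hk⟩ := hA m
    have := hm.length_answers_le_of_haltsWith hp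
    simp only [List.length_map] at this
    omega
  -- Take an adversary run with the most queries and continue the run on a metric that realizes it
  -- until it halts. Only tests can follow, as another query would yield a longer adversary run, so
  -- the adversary state no longer changes.
  let S : Set ℕ := {k | ∃ h a, ∃ d : Fin n → Fin n → ℕ∞, A.AdvRun h a d ∧ a.length = k}
  have hS : S.Nonempty := ⟨0, [], [], _, .start, rfl⟩
  have hSb : BddAbove S := ⟨q, by rintro _ ⟨h, a, d, H, rfl⟩; exact bdd H⟩
  obtain ⟨h, a, d, H, hmax⟩ := Nat.sSup_mem hS hSb
  obtain ⟨m, hm⟩ := real H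
  obtain ⟨p, k, ⟨h', a', hr, hp, -⟩, -⟩ := hA m
  have key : ∀ {h' a'}, A.Reaches m h' a' → h.length ≤ h'.length → A.AdvRun h' a d := by
    intro h' a' hr
    suffices h.length ≤ h'.length → A.AdvRun h' a d ∧ a' = a.map (Nat.cast : ℕ → ℝ) from
      fun hl => (this hl).1
    induction hr with
    | start =>
      intro hl
      have : h = [] := by simpa using hl
      subst this
      exact ⟨H, (hm.eq_of_length_eq .start rfl).2.symm⟩
    | @query h₁ a₁ x y hr' hn' ih =>
      intro hl
      rcases hl.lt_or_eq with hlt | heq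
      · have h1 := (ih (by simpa [Nat.lt_succ_iff] using hlt)).1
        have h2 : (a ++ [answer d x y]).length ∈ S := ⟨_, _, _, .query x y h1 hn', rfl⟩
        have h3 := le_csSup hSb h2
        rw [← hmax, List.length_append, List.length_singleton] at h3
        omega
      · obtain ⟨rfl, h2⟩ := hm.eq_of_length_eq (.query x y hr' hn') heq
        exact ⟨H, h2.symm⟩
    | @test h₁ a₁ P hr' hn' ih =>
      intro hl
      rcases hl.lt_or_eq with hlt | heq
      · obtain ⟨h1, rfl⟩ := ih (by simpa [Nat.lt_succ_iff] using hlt)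
        exact ⟨.test P h1 hn', rfl⟩
      · obtain ⟨rfl, h2⟩ := hm.eq_of_length_eq (.test P hr' hn') heq
        exact ⟨H, h2.symm⟩
  exact ⟨h', a, d, p, key hr (hr.length_le_of_output hp hm), hp⟩

/-- A run with a bad output. -/
def IsBadRun (A : Algorithm) {n : ℕ} (D : Fin n → Fin n → ℕ) (h : List Bool) (a : List ℕ)
    (p z : Fin n) : Prop :=
  IsPseudo D ∧ A.ValidRun D h a ∧ A.next n h = Instr.output p ∧
    (n ≤ 2 * a.length + 1 ∨ IsBadChoice D p a.length z)

theorem exists_isBadRun {A : Algorithm} {n q : ℕ}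
    (hA : ∀ m : MetricSpace (Fin n), ∃ p k, A.HaltsWith m p k ∧ k ≤ q) :
    ∃ (D : Fin n → Fin n → ℕ) (h : List Bool) (a : List ℕ) (p z : Fin n),
      A.IsBadRun D h a p z := by
  obtain ⟨h, a, d, p, H, hp⟩ := exists_advRun_output hA
  have hd := H.isTame
  have hD := isPseudo_hubDist hd.toIsExtMetric
    (level_lipschitz hd.toIsExtMetric p (Nat.log 2 n / 8))
  have hv := H.validRun (isCompatible_hubDist (l := level d p (Nat.log 2 n / 8))
    fun s => le_max_left _ _)
  -- Without a guaranteed untouched point nothing is claimed. The first alternative still gives a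
  -- certificate for every n, and it is excluded for large n by the query bound.
  rcases le_or_gt n (2 * a.length + 1) with hq | hq
  · exact ⟨_, h, a, p, p, hD, hv, hp, .inl hq⟩
  · obtain ⟨z, hz⟩ := hd.exists_isBadChoice hq p
    exact ⟨_, h, a, p, z, hD, hv, hp, .inr hz⟩

end Algorithm

end MetricMedian

/-! ### Primitive recursive verification of runs with natural answers -/

namespace MetricMedian

section Primrec

theorem primrec_pow : Primrec₂ ((· ^ ·) : ℕ → ℕ → ℕ) := Primrec₂.unpaired'.1 Nat.Primrec.pow

theorem primrec_log_two : Primrec (Nat.log 2) := by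
  have h : Primrec fun n : ℕ => Nat.findGreatest (fun k => 2 ^ k ≤ n) n :=
    Primrec.nat_findGreatest Primrec.id
      (Primrec.nat_le.comp (primrec_pow.comp (.const 2) .snd) .fst)
  refine h.of_eq fun n => ?_
  rcases Nat.eq_zero_or_pos n with rfl | hn
  · simp
  · rw [Nat.findGreatest_eq_iff]
    refine ⟨Nat.log_le_self 2 n, fun _ => Nat.pow_log_le_self 2 hn.ne', fun k hk _ h => ?_⟩
    exact absurd (Nat.le_log_of_pow_le (by norm_num) h) (by omega)

theorem primrec_list_sum : Primrec (List.sum : List ℕ → ℕ) := by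
  have h : Primrec fun l : List ℕ => l.foldr (fun b s => b + s) 0 :=
    Primrec.list_foldr .id (.const 0)
      (Primrec.nat_add.comp (Primrec.fst.comp .snd) (Primrec.snd.comp .snd)).to₂
  exact h.of_eq fun l => by induction l <;> simp_all

theorem primrec_list_prod : Primrec (List.prod : List ℕ → ℕ) := by
  have h : Primrec fun l : List ℕ => l.foldr (fun b s => b * s) 1 :=
    Primrec.list_foldr .id (.const 1)
      (Primrec.nat_mul.comp (Primrec.fst.comp .snd) (Primrec.snd.comp .snd)).to₂
  exact h.of_eq fun l => by induction l <;> simp_all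

/-- Integers are encoded by parity: k as 2k and -(k+1) as 2k + 1. -/
theorem primrec_int_toNat : Primrec Int.toNat := by
  have h : Primrec fun c : ℤ =>
      if Encodable.encode c % 2 = 0 then Encodable.encode c / 2 else 0 :=
    .ite (Primrec.eq.comp (Primrec.nat_mod.comp .encode (.const 2)) (.const 0))
      (Primrec.nat_div.comp .encode (.const 2)) (.const 0)
  refine h.of_eq fun c => ?_
  cases c with
  | ofNat k =>
    rw [show Encodable.encode (Int.ofNat k) = 2 * k from rfl]
    simp
  | negSucc k =>
    rw [show Encodable.encode (Int.negSucc k) = 2 * k + 1 from rfl]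
    rw [if_neg (by omega)]
    rfl

theorem primrec_int_neg_toNat : Primrec fun c : ℤ => (-c).toNat := by
  have h : Primrec fun c : ℤ =>
      if Encodable.encode c % 2 = 0 then 0 else Encodable.encode c / 2 + 1 :=
    .ite (Primrec.eq.comp (Primrec.nat_mod.comp .encode (.const 2)) (.const 0))
      (.const 0) (Primrec.succ.comp (Primrec.nat_div.comp .encode (.const 2)))
  refine h.of_eq fun c => ?_
  cases c with
  | ofNat k =>
    rw [show Encodable.encode (Int.ofNat k) = 2 * k from rfl]
    simp
  | negSucc k =>
    rw [show Encodable.encode (Int.negSucc k) = 2 * k + 1 from rfl, if_neg (by omega),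
      Int.neg_negSucc]
    rw [Int.toNat_natCast]
    omega

theorem primrecPred_forall_lt {α : Type*} [Primcodable α] {f : α → ℕ} {R : α → ℕ → Prop}
    (hf : Primrec f) (hR : PrimrecPred fun p : α × ℕ => R p.1 p.2) :
    PrimrecPred fun a => ∀ x < f a, R a x := by
  have h : PrimrecRel fun (x : ℕ) (a : α) => R a x := hR.comp (.pair .snd .fst)
  exact (h.forall_mem_list.comp (Primrec.list_range.comp hf) .id).of_eq fun a => by simp

theorem primrec_sum_range {α : Type*} [Primcodable α] {f : α → ℕ} {g : α → ℕ → ℕ}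
    (hf : Primrec f) (hg : Primrec₂ g) : Primrec fun a => ∑ i ∈ Finset.range (f a), g a i :=
  (primrec_list_sum.comp (Primrec.list_map (Primrec.list_range.comp hf) hg)).of_eq fun _ => rfl

theorem primrec_sparsity : Primrec₂ sparsity := by
  unfold sparsity
  exact Primrec.nat_max.comp (.const 1) (Primrec.nat_min.comp
    (Primrec.nat_div.comp .fst (Primrec.succ.comp .snd))
    (primrec_pow.comp (.const 2)
      (Primrec.nat_div.comp (primrec_log_two.comp .fst) (.const 8))))

end Primrec

section Evaluation

/-- The product of the entries of `a` with the given indices. -/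
def monomial (a : List ℕ) (l : List ℕ) : ℕ := (l.map fun i => a.getD i 0).prod

/-- The sign test of a polynomial at natural numbers. -/
def isNonneg (P : RealPoly) (a : List ℕ) : Bool :=
  decide ((P.map fun t => (-t.1).toNat * monomial a t.2).sum ≤
    (P.map fun t => t.1.toNat * monomial a t.2).sum)

theorem primrec_isNonneg : Primrec₂ isNonneg := by
  have hm : Primrec₂ monomial :=
    primrec_list_prod.comp (Primrec.list_map .snd
      ((Primrec.list_getD 0).comp (Primrec.fst.comp .fst) .snd).to₂)
  have h : ∀ f : ℤ → ℕ, Primrec f → Primrec fun p : RealPoly × List ℕ =>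
      (p.1.map fun t => f t.1 * monomial p.2 t.2).sum := fun f hf =>
    primrec_list_sum.comp (Primrec.list_map .fst
      (Primrec.nat_mul.comp (hf.comp (Primrec.fst.comp .snd))
        (hm.comp (Primrec.snd.comp .fst) (Primrec.snd.comp .snd))).to₂)
  exact (Primrec.nat_le.comp (h _ primrec_int_neg_toNat) (h _ primrec_int_toNat)).decide

theorem getD_map_cast (a : List ℕ) (i : ℕ) :
    (a.map (Nat.cast : ℕ → ℝ)).getD i 0 = (a.getD i 0 : ℕ) := by
  simp only [List.getD_eq_getElem?_getD, List.getElem?_map]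
  cases a[i]? <;> simp

/-- Splitting the coefficients into positive and negative parts reduces a real sign test at natural
answers to a comparison of natural numbers. -/
theorem eval_map_cast (P : RealPoly) (a : List ℕ) :
    P.eval (a.map (Nat.cast : ℕ → ℝ)) =
      ((P.map fun t => t.1.toNat * monomial a t.2).sum : ℕ) -
        ((P.map fun t => (-t.1).toNat * monomial a t.2).sum : ℕ) := by
  induction P with
  | nil => simp [RealPoly.eval]
  | cons t P ih =>
    have hm : (t.2.map fun i => (a.map (Nat.cast : ℕ → ℝ)).getD i 0).prod =
        (monomial a t.2 : ℝ) := by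
      simp only [getD_map_cast]
      rw [monomial, Nat.cast_list_prod, List.map_map]
      rfl
    have hc : (t.1 : ℝ) = (t.1.toNat : ℝ) - ((-t.1).toNat : ℝ) := by
      conv_lhs => rw [← Int.toNat_sub_toNat_neg t.1]
      push_cast
      rfl
    rw [RealPoly.eval] at ih ⊢
    rw [List.map_cons, List.sum_cons, ih, hm, List.map_cons, List.sum_cons, List.map_cons,
      List.sum_cons, hc]
    push_cast
    ring

theorem isNonneg_eq_true_iff (P : RealPoly) (a : List ℕ) :
    isNonneg P a = true ↔ 0 ≤ P.eval (a.map (Nat.cast : ℕ → ℝ)) := by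
  rw [isNonneg, decide_eq_true_iff, eval_map_cast, sub_nonneg, Nat.cast_le]

end Evaluation

section Simulation

/-- An entry of a distance table. -/
def tableDist (n : ℕ) (D : List ℕ) (x y : ℕ) : ℕ := D.getD (x * n + y) 0

/-- Check an instruction and its result, and update the list of answers. -/
def simStep (n : ℕ) (D : List ℕ) (a : List ℕ) : Instr → Bool → Option (List ℕ)
  | Sum.inl _, _ => none
  | Sum.inr (Sum.inl (x, y)), b =>
    if (x < n ∧ y < n ∧ (x = y ∨ tableDist n D x y ≠ 0)) ∧ b = true then
      some (a ++ [tableDist n D x y]) else none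
  | Sum.inr (Sum.inr P), b => if b = isNonneg P a then some a else none

/-- Check a sequence of instructions and their results. -/
def simRun (n : ℕ) (D : List ℕ) (L : List (Instr × Bool)) : Option (List ℕ) :=
  L.foldl (fun s t => s.bind fun a => simStep n D a t.1 t.2) (some [])

theorem simRun_concat (n : ℕ) (D : List ℕ) (L : List (Instr × Bool)) (t : Instr × Bool) :
    simRun n D (L ++ [t]) = (simRun n D L).bind fun a => simStep n D a t.1 t.2 := by
  simp [simRun]

theorem primrec_tableDist {α : Type*} [Primcodable α] {n x y : α → ℕ} {D : α → List ℕ}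
    (hn : Primrec n) (hD : Primrec D) (hx : Primrec x) (hy : Primrec y) :
    Primrec fun a => tableDist (n a) (D a) (x a) (y a) :=
  (Primrec.list_getD 0).comp hD (Primrec.nat_add.comp (Primrec.nat_mul.comp hx hn) hy)

theorem primrec_simStep {α : Type*} [Primcodable α] {n : α → ℕ} {D a : α → List ℕ}
    {I : α → Instr} {b : α → Bool} (hn : Primrec n) (hD : Primrec D) (ha : Primrec a)
    (hI : Primrec I) (hb : Primrec b) :
    Primrec fun p => simStep (n p) (D p) (a p) (I p) (b p) := by
  have h1 : Primrec₂ fun (p : α) (xy : ℕ × ℕ) =>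
      if (xy.1 < n p ∧ xy.2 < n p ∧ (xy.1 = xy.2 ∨ tableDist (n p) (D p) xy.1 xy.2 ≠ 0)) ∧
        b p = true then some (a p ++ [tableDist (n p) (D p) xy.1 xy.2]) else none := by
    have hx : Primrec fun q : α × (ℕ × ℕ) => q.2.1 := Primrec.fst.comp .snd
    have hy : Primrec fun q : α × (ℕ × ℕ) => q.2.2 := Primrec.snd.comp .snd
    have hn' : Primrec fun q : α × (ℕ × ℕ) => n q.1 := hn.comp .fst
    have ht : Primrec fun q : α × (ℕ × ℕ) => tableDist (n q.1) (D q.1) q.2.1 q.2.2 :=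
      primrec_tableDist hn' (hD.comp .fst) hx hy
    refine Primrec.ite (PrimrecPred.and (PrimrecPred.and (Primrec.nat_lt.comp hx hn')
      (PrimrecPred.and (Primrec.nat_lt.comp hy hn') (PrimrecPred.or (Primrec.eq.comp hx hy)
        (PrimrecPred.not (Primrec.eq.comp ht (.const 0))))))
      (Primrec.eq.comp (hb.comp .fst) (.const true))) ?_ (.const none)
    exact Primrec.option_some.comp (Primrec.list_concat.comp (ha.comp .fst) ht)
  have h2 : Primrec₂ fun (p : α) (P : RealPoly) =>
      if b p = isNonneg P (a p) then some (a p) else none :=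
    Primrec.ite (Primrec.eq.comp (hb.comp .fst) (primrec_isNonneg.comp .snd (ha.comp .fst)))
      (Primrec.option_some.comp (ha.comp .fst)) (.const none)
  have h3 : Primrec₂ fun (p : α) (J : (ℕ × ℕ) ⊕ RealPoly) =>
      simStep (n p) (D p) (a p) (Sum.inr J) (b p) := by
    refine (Primrec.sumCasesOn (f := fun q : α × ((ℕ × ℕ) ⊕ RealPoly) => q.2) .snd
      (h1.comp (Primrec.fst.comp .fst) .snd).to₂
      (h2.comp (Primrec.fst.comp .fst) .snd).to₂).of_eq fun q => ?_
    rcases q with ⟨p, ⟨x, y⟩ | P⟩ <;> rfl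
  refine (Primrec.sumCasesOn hI (Primrec.const none).to₂ h3).of_eq fun p => ?_
  rcases I p with o | J <;> rfl

theorem primrec_simRun {α : Type*} [Primcodable α] {n : α → ℕ} {D : α → List ℕ}
    {L : α → List (Instr × Bool)} (hn : Primrec n) (hD : Primrec D) (hL : Primrec L) :
    Primrec fun p => simRun (n p) (D p) (L p) := by
  refine Primrec.list_foldl hL (.const _) (?_ : Primrec₂ fun (p : α)
    (st : Option (List ℕ) × (Instr × Bool)) =>
      st.1.bind fun a => simStep (n p) (D p) a st.2.1 st.2.2)
  refine Primrec.option_bind (Primrec.fst.comp .snd) ?_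
  refine primrec_simStep (hn.comp (Primrec.fst.comp .fst)) (hD.comp (Primrec.fst.comp .fst)) .snd
    ?_ ?_
  · exact Primrec.fst.comp (Primrec.snd.comp (Primrec.snd.comp .fst))
  · exact Primrec.snd.comp (Primrec.snd.comp (Primrec.snd.comp .fst))

namespace Algorithm

/-- The first `k` instructions that belong to a history, with their results. -/
def traceUpTo (A : Algorithm) (n : ℕ) (h : List Bool) (k : ℕ) : List (Instr × Bool) :=
  k.rec [] fun i acc => acc ++ [(A.next n (h.take i), h.getD i false)]

/-- The instructions that belong to a history, with their results. -/
def trace (A : Algorithm) (n : ℕ) (h : List Bool) : List (Instr × Bool) :=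
  A.traceUpTo n h h.length

theorem trace_concat (A : Algorithm) (n : ℕ) (h : List Bool) (b : Bool) :
    A.trace n (h ++ [b]) = A.trace n h ++ [(A.next n h, b)] := by
  have key : ∀ k ≤ h.length, A.traceUpTo n (h ++ [b]) k = A.traceUpTo n h k := by
    intro k
    induction k with
    | zero => exact fun _ => rfl
    | succ k ih =>
      intro hk
      simp only [traceUpTo] at ih ⊢
      rw [ih (by omega), List.take_append_of_le_length (by omega),
        List.getD_append _ _ _ _ (by omega)]
  rw [trace, List.length_append, List.length_singleton]
  change A.traceUpTo n (h ++ [b]) h.length ++ _ = _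
  rw [key _ le_rfl, trace]
  simp

/-- The control is only computable, not primitive recursive. Listing its instructions beforehand
separates it from the verification, which is primitive recursive. -/
theorem computable_trace (A : Algorithm) : Computable₂ A.trace := by
  have hl : Computable fun p : ℕ × List Bool => p.2.length := Computable.list_length.comp .snd
  have hs : Computable₂ fun (p : ℕ × List Bool) (s : ℕ × List (Instr × Bool)) =>
      s.2 ++ [(A.next p.1 (p.2.take s.1), p.2.getD s.1 false)] :=
    Computable.list_concat.comp (Computable.snd.comp .snd) (Computable.pair
      (A.computable_next.comp (Computable.fst.comp .fst)
        (Primrec.list_take.to_comp.comp (Computable.fst.comp .snd) (Computable.snd.comp .fst)))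
      ((Primrec.list_getD false).to_comp.comp (Computable.snd.comp .fst)
        (Computable.fst.comp .snd)))
  exact Computable.nat_rec hl (.const []) hs

/-- Soundness and completeness of the verification: runs on a table of natural distances become
decidable. -/
theorem simRun_trace_iff (A : Algorithm) {n : ℕ} (T : List ℕ) (D : Fin n → Fin n → ℕ)
    (hT : ∀ x y : Fin n, tableDist n T x y = D x y) (h : List Bool) (a : List ℕ) :
    simRun n T (A.trace n h) = some a ↔ A.ValidRun D h a := by
  induction h using List.reverseRecOn generalizing a with
  | nil =>
    constructor
    · intro H
      obtain rfl : [] = a := by simpa [trace, traceUpTo, simRun] using H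
      exact .start
    · intro H
      generalize hh : ([] : List Bool) = h at H
      cases H with
      | start => simp [trace, traceUpTo, simRun]
      | query => simp at hh
      | test => simp at hh
  | append_singleton h b ih =>
    rw [trace_concat, simRun_concat, Option.bind_eq_some_iff]
    constructor
    · rintro ⟨a', ha', hs⟩
      have H := (ih a').1 ha'
      simp only at hs
      rcases hI : A.next n h with o | ⟨x, y⟩ | P
      · rw [hI] at hs
        simp [simStep] at hs
      · rw [hI, simStep] at hs
        split_ifs at hs with hc
        obtain ⟨⟨hx, hy, hxy⟩, rfl⟩ := hc
        have hxy' := hT ⟨x, hx⟩ ⟨y, hy⟩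
        simp only at hxy'
        rw [hxy'] at hs hxy
        obtain rfl := Option.some.inj hs
        exact .query ⟨x, hx⟩ ⟨y, hy⟩ H hI (by simpa [Fin.ext_iff] using hxy)
      · rw [hI, simStep] at hs
        split_ifs at hs with hc
        obtain rfl := Option.some.inj hs
        have : b = decide (0 ≤ P.eval (a'.map (Nat.cast : ℕ → ℝ))) := by
          rw [hc, Bool.eq_iff_iff, isNonneg_eq_true_iff, decide_eq_true_iff]
        rw [this]
        exact .test P H hI
    · intro H
      generalize hh : h ++ [b] = h' at H
      cases H with
      | start => simp at hh
      | @query h₁ a₁ x y H hn hxy =>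
        obtain ⟨rfl, hb⟩ := List.append_inj' hh rfl
        obtain rfl : b = true := by simpa using hb
        refine ⟨a₁, (ih a₁).2 H, ?_⟩
        simp only
        rw [hn, simStep, if_pos]
        · rw [hT]
        · exact ⟨⟨x.2, y.2, by simpa [hT, Fin.ext_iff] using hxy⟩, rfl⟩
      | @test h₁ a₁ P H hn =>
        obtain ⟨rfl, hb⟩ := List.append_inj' hh rfl
        refine ⟨_, (ih _).2 H, ?_⟩
        simp only
        rw [hn, simStep, if_pos]
        rw [List.cons.injEq] at hb
        rw [hb.1, Bool.eq_iff_iff, isNonneg_eq_true_iff, decide_eq_true_iff]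

end Algorithm

end Simulation

end MetricMedian

/-! ### Searching for a certificate of a bad run -/

namespace MetricMedian

/-- The first `n` rows and columns of a distance table form a pseudometric. -/
def IsPseudoTable (n : ℕ) (T : List ℕ) : Prop :=
  ∀ x < n, tableDist n T x x = 0 ∧ ∀ y < n, tableDist n T x y = tableDist n T y x ∧
    ∀ w < n, tableDist n T x w ≤ tableDist n T x y + tableDist n T y w

theorem primrecPred_isPseudoTable {α : Type*} [Primcodable α] {n : α → ℕ} {T : α → List ℕ}
    (hn : Primrec n) (hT : Primrec T) : PrimrecPred fun a => IsPseudoTable (n a) (T a) := by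
  refine primrecPred_forall_lt hn (PrimrecPred.and (Primrec.eq.comp
    (primrec_tableDist (hn.comp .fst) (hT.comp .fst) .snd .snd) (.const 0)) ?_)
  refine primrecPred_forall_lt (hn.comp .fst) ?_
  have hn2 : Primrec fun p : (α × ℕ) × ℕ => n p.1.1 := hn.comp (Primrec.fst.comp .fst)
  have hT2 : Primrec fun p : (α × ℕ) × ℕ => T p.1.1 := hT.comp (Primrec.fst.comp .fst)
  have hx2 : Primrec fun p : (α × ℕ) × ℕ => p.1.2 := Primrec.snd.comp .fst
  refine PrimrecPred.and (Primrec.eq.comp (primrec_tableDist hn2 hT2 hx2 .snd)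
    (primrec_tableDist hn2 hT2 .snd hx2)) ?_
  refine primrecPred_forall_lt hn2 (Primrec.nat_le.comp ?_ (Primrec.nat_add.comp ?_ ?_))
  · exact primrec_tableDist (hn2.comp .fst) (hT2.comp .fst) (hx2.comp .fst) .snd
  · exact primrec_tableDist (hn2.comp .fst) (hT2.comp .fst) (hx2.comp .fst)
      (Primrec.snd.comp .fst)
  · exact primrec_tableDist (hn2.comp .fst) (hT2.comp .fst) (Primrec.snd.comp .fst) .snd

/-- The sum of a row of a distance table. -/
def tableSum (n : ℕ) (T : List ℕ) (x : ℕ) : ℕ := ∑ y ∈ Finset.range n, tableDist n T x y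

theorem primrec_tableSum {α : Type*} [Primcodable α] {n x : α → ℕ} {T : α → List ℕ}
    (hn : Primrec n) (hT : Primrec T) (hx : Primrec x) :
    Primrec fun a => tableSum (n a) (T a) (x a) :=
  primrec_sum_range hn (primrec_tableDist (hn.comp .fst) (hT.comp .fst) (hx.comp .fst) .snd).to₂

/-- The table `T` and the points `p` and `z` certify that a run with `q` queries and the final
instruction `I` is a bad run on `n` points. -/
def IsBadTable (n : ℕ) (T : List ℕ) (p z q : ℕ) (I : Instr) : Prop :=
  I = Instr.output p ∧ p < n ∧ z < n ∧ IsPseudoTable n T ∧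
    (n ≤ 2 * q + 1 ∨ n * (Nat.log 2 n / 8) ≤ tableSum n T p + tableSum n T z ∧
      sparsity n q * tableSum n T z ≤ 7 * n)

theorem primrecPred_isBadTable {α : Type*} [Primcodable α] {n p z q : α → ℕ} {T : α → List ℕ}
    {I : α → Instr} (hn : Primrec n) (hT : Primrec T) (hp : Primrec p) (hz : Primrec z)
    (hq : Primrec q) (hI : Primrec I) :
    PrimrecPred fun a => IsBadTable (n a) (T a) (p a) (z a) (q a) (I a) := by
  have hsp := primrec_tableSum hn hT hp
  have hsz := primrec_tableSum hn hT hz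
  refine PrimrecPred.and (Primrec.eq.comp hI (Primrec.sumInl.comp hp)) (PrimrecPred.and
    (Primrec.nat_lt.comp hp hn) (PrimrecPred.and (Primrec.nat_lt.comp hz hn) (PrimrecPred.and
    (primrecPred_isPseudoTable hn hT) (PrimrecPred.or ?_ (PrimrecPred.and ?_ ?_)))))
  · exact Primrec.nat_le.comp hn
      (Primrec.succ.comp (Primrec.nat_mul.comp (.const 2) hq))
  · exact Primrec.nat_le.comp (Primrec.nat_mul.comp hn (Primrec.nat_div.comp
      (primrec_log_two.comp hn) (.const 8))) (Primrec.nat_add.comp hsp hsz)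
  · exact Primrec.nat_le.comp (Primrec.nat_mul.comp (primrec_sparsity.comp hn hq) hsz)
      (Primrec.nat_mul.comp (.const 7) hn)

/-- The distance table of `D`. -/
def toTable {n : ℕ} (D : Fin n → Fin n → ℕ) : List ℕ :=
  (List.range (n * n)).map fun k =>
    if h : k / n < n ∧ k % n < n then D ⟨k / n, h.1⟩ ⟨k % n, h.2⟩ else 0

theorem tableDist_toTable {n : ℕ} (D : Fin n → Fin n → ℕ) (x y : Fin n) :
    tableDist n (toTable D) x y = D x y := by
  have hn : 0 < n := x.pos
  have h1 : (x * n + y) / n = (x : ℕ) := by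
    rw [mul_comm, Nat.mul_add_div hn, Nat.div_eq_of_lt y.2, add_zero]
  have h2 : (x * n + y) % n = (y : ℕ) := by
    rw [mul_comm, Nat.mul_add_mod, Nat.mod_eq_of_lt y.2]
  have h3 : (x * n + y : ℕ) < n * n := by
    calc (x * n + y : ℕ) < x * n + n := by have := y.2; omega
      _ = (x + 1) * n := by ring
      _ ≤ n * n := Nat.mul_le_mul_right _ x.2
  rw [tableDist, toTable, List.getD_eq_getElem?_getD, List.getElem?_map,
    List.getElem?_range h3]
  simp [h1, h2]

theorem tableSum_eq {n : ℕ} {T : List ℕ} {D : Fin n → Fin n → ℕ}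
    (hT : ∀ x y : Fin n, tableDist n T x y = D x y) (x : Fin n) :
    tableSum n T x = ∑ y, D x y := by
  rw [tableSum, Finset.sum_range]
  exact Finset.sum_congr rfl fun y _ => hT x y

theorem isPseudoTable_iff {n : ℕ} {T : List ℕ} {D : Fin n → Fin n → ℕ}
    (hT : ∀ x y : Fin n, tableDist n T x y = D x y) : IsPseudoTable n T ↔ IsPseudo D := by
  constructor
  · intro h
    refine ⟨fun s => ?_, fun s t => ?_, fun s t u => ?_⟩
    · rw [← hT]
      exact (h s s.2).1
    · rw [← hT, ← hT]
      exact ((h s s.2).2 t t.2).1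
    · rw [← hT, ← hT, ← hT]
      exact ((h s s.2).2 t t.2).2 u u.2
  · intro h x hx
    refine ⟨(hT ⟨x, hx⟩ ⟨x, hx⟩).trans (h.self _), fun y hy => ⟨?_, fun w hw => ?_⟩⟩
    · exact (hT ⟨x, hx⟩ ⟨y, hy⟩).trans ((h.symm _ _).trans (hT ⟨y, hy⟩ ⟨x, hx⟩).symm)
    · have := h.triangle ⟨x, hx⟩ ⟨y, hy⟩ ⟨w, hw⟩
      rwa [← hT, ← hT, ← hT] at this

namespace Algorithm

open Classical in
/-- Check a bad run on `n ≥ 1` points and extract a lower bound for the approximation ratio. -/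
noncomputable def checkRun (n : ℕ) (T : List ℕ) (p z : ℕ) (I : Instr) (L : List (Instr × Bool)) :
    Option ℕ :=
  (simRun n T L).bind fun a =>
    if n = 0 ∨ IsBadTable n T p z a.length I then some (sparsity n a.length) else none

theorem primrec_checkRun {α : Type*} [Primcodable α] {n p z : α → ℕ} {T : α → List ℕ}
    {I : α → Instr} {L : α → List (Instr × Bool)} (hn : Primrec n) (hT : Primrec T)
    (hp : Primrec p) (hz : Primrec z) (hI : Primrec I) (hL : Primrec L) :
    Primrec fun a => checkRun (n a) (T a) (p a) (z a) (I a) (L a) := by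
  classical
  refine Primrec.option_bind (primrec_simRun hn hT hL) ?_
  have hl : Primrec fun b : α × List ℕ => b.2.length := Primrec.list_length.comp .snd
  refine Primrec.ite (PrimrecPred.or (Primrec.eq.comp (hn.comp .fst) (.const 0))
    (primrecPred_isBadTable (hn.comp .fst) (hT.comp .fst) (hp.comp .fst) (hz.comp .fst) hl
      (hI.comp .fst))) ?_ (.const none)
  exact Primrec.option_some.comp (primrec_sparsity.comp (hn.comp .fst) hl)

/-- Check the `c`-th candidate for a bad run of `A` on `n` points. -/
noncomputable def checkCode (A : Algorithm) (n c : ℕ) : Option ℕ :=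
  (Encodable.decode (α := List ℕ × List Bool × ℕ × ℕ) c).bind fun t =>
    checkRun n t.1 t.2.2.1 t.2.2.2 (A.next n t.2.1) (A.trace n t.2.1)

theorem computable_checkRun {α : Type*} [Primcodable α] {n p z : α → ℕ} {T : α → List ℕ}
    {I : α → Instr} {L : α → List (Instr × Bool)} (hn : Computable n) (hT : Computable T)
    (hp : Computable p) (hz : Computable z) (hI : Computable I) (hL : Computable L) :
    Computable fun a => checkRun (n a) (T a) (p a) (z a) (I a) (L a) := by
  have h : Primrec fun u : ℕ × List ℕ × ℕ × ℕ × Instr × List (Instr × Bool) =>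
      checkRun u.1 u.2.1 u.2.2.1 u.2.2.2.1 u.2.2.2.2.1 u.2.2.2.2.2 := by
    have h3 : Primrec fun u : ℕ × List ℕ × ℕ × ℕ × Instr × List (Instr × Bool) => u.2.2 :=
      Primrec.snd.comp .snd
    have h4 := Primrec.snd.comp h3
    have h5 := Primrec.snd.comp h4
    exact primrec_checkRun .fst (Primrec.fst.comp .snd) (Primrec.fst.comp h3)
      (Primrec.fst.comp h4) (Primrec.fst.comp h5) (Primrec.snd.comp h5)
  exact h.to_comp.comp (hn.pair (hT.pair (hp.pair (hz.pair (hI.pair hL)))))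

theorem computable_checkCode (A : Algorithm) : Computable₂ A.checkCode := by
  have hn : Computable fun u : (ℕ × ℕ) × List ℕ × List Bool × ℕ × ℕ => u.1.1 :=
    Computable.fst.comp .fst
  have ht : Computable fun u : (ℕ × ℕ) × List ℕ × List Bool × ℕ × ℕ => u.2 := .snd
  have h2 : Computable fun u : (ℕ × ℕ) × List ℕ × List Bool × ℕ × ℕ => u.2.2 :=
    Computable.snd.comp ht
  have hh := Computable.fst.comp h2
  have h3 := Computable.snd.comp h2
  have hg : Computable₂ fun (u : ℕ × ℕ) (t : List ℕ × List Bool × ℕ × ℕ) =>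
      checkRun u.1 t.1 t.2.2.1 t.2.2.2 (A.next u.1 t.2.1) (A.trace u.1 t.2.1) :=
    computable_checkRun hn (Computable.fst.comp ht) (Computable.fst.comp h3)
      (Computable.snd.comp h3) (A.computable_next.comp hn hh) (A.computable_trace.comp hn hh)
  have hd : Computable fun u : ℕ × ℕ =>
      Encodable.decode (α := List ℕ × List Bool × ℕ × ℕ) u.2 := Computable.decode.comp .snd
  exact Computable.option_bind hd hg

theorem exists_isBadRun_of_checkCode {A : Algorithm} {n c v : ℕ} (hn : 1 ≤ n)
    (h : A.checkCode n c = some v) :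
    ∃ (D : Fin n → Fin n → ℕ) (h : List Bool) (a : List ℕ) (p z : Fin n),
      A.IsBadRun D h a p z ∧ v = sparsity n a.length := by
  rw [checkCode, Option.bind_eq_some_iff] at h
  obtain ⟨⟨T, h, p, z⟩, -, h⟩ := h
  simp only [checkRun] at h
  rw [Option.bind_eq_some_iff] at h
  obtain ⟨a, ha, h⟩ := h
  split_ifs at h with hc
  obtain ⟨hp, hpn, hzn, hT, hbad⟩ := hc.resolve_left (by omega)
  have hTD : ∀ x y : Fin n, tableDist n T x y = (fun x y : Fin n => tableDist n T x y) x y :=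
    fun _ _ => rfl
  refine ⟨fun x y => tableDist n T x y, _, a, ⟨p, hpn⟩, ⟨z, hzn⟩,
    ⟨(isPseudoTable_iff hTD).1 hT, (simRun_trace_iff A T _ hTD _ a).1 ha, hp, ?_⟩,
    (Option.some.inj h).symm⟩
  refine hbad.imp_right fun hb => ?_
  have hsp := tableSum_eq hTD ⟨p, hpn⟩
  have hsz := tableSum_eq hTD ⟨z, hzn⟩
  simp only at hsp hsz
  rw [hsp, hsz] at hb
  exact hb

theorem exists_checkCode_of_isBadRun {A : Algorithm} {n : ℕ} {D : Fin n → Fin n → ℕ}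
    {h : List Bool} {a : List ℕ} {p z : Fin n} (H : A.IsBadRun D h a p z) :
    ∃ c v, A.checkCode n c = some v := by
  obtain ⟨hD, hr, hp, hbad⟩ := H
  have hTD := tableDist_toTable D
  refine ⟨Encodable.encode (toTable D, h, (p : ℕ), (z : ℕ)), sparsity n a.length, ?_⟩
  rw [checkCode, Encodable.encodek, Option.bind_some]
  simp only [checkRun]
  rw [(simRun_trace_iff A _ D hTD h a).2 hr, Option.bind_some, if_pos]
  refine .inr ⟨hp, p.2, z.2, (isPseudoTable_iff hTD).2 hD, hbad.imp_right fun hb => ?_⟩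
  rw [tableSum_eq hTD, tableSum_eq hTD]
  exact hb

/-- A computable lower bound for the approximation ratio, up to a logarithm. -/
theorem exists_computable_sparsity {A : Algorithm} {q : ℕ → ℕ}
    (hA : ∀ n, 1 ≤ n → ∀ m : MetricSpace (Fin n), ∃ p k, A.HaltsWith m p k ∧ k ≤ q n) :
    ∃ f : ℕ → ℕ, Computable f ∧ ∀ n, 1 ≤ n →
      ∃ (D : Fin n → Fin n → ℕ) (h : List Bool) (a : List ℕ) (p z : Fin n),
        A.IsBadRun D h a p z ∧ f n = sparsity n a.length := by
  -- The search has to be total. For n = 0 every valid trace is accepted, here the empty one; for n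
  -- ≥ 1 the adversary provides a certificate.
  have hdom : ∀ n, (Nat.rfindOpt (A.checkCode n)).Dom := fun n => by
    rw [Nat.rfindOpt_dom]
    rcases Nat.eq_zero_or_pos n with rfl | hn
    · refine ⟨Encodable.encode (([] : List ℕ), ([] : List Bool), 0, 0), sparsity 0 0, ?_⟩
      rw [checkCode, Encodable.encodek, Option.bind_some, Option.mem_def]
      simp [checkRun, simRun, trace, traceUpTo]
    · obtain ⟨D, h, a, p, z, H⟩ := exists_isBadRun (hA n hn)
      exact exists_checkCode_of_isBadRun H
  refine ⟨fun n => (Nat.rfindOpt (A.checkCode n)).get (hdom n),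
    (Partrec.rfindOpt A.computable_checkCode).of_eq_tot fun n => Part.get_mem _, fun n hn => ?_⟩
  obtain ⟨c, hc⟩ := Nat.rfindOpt_spec (Part.get_mem (hdom n))
  exact exists_isBadRun_of_checkCode hn hc

end Algorithm

end MetricMedian

/-! ### Walks in the de Bruijn graph -/

namespace MetricMedian

section DeBruijn

/-- The index of the `i`-th edge on the path from `p` to `y` in the de Bruijn graph on `2 ^ H`
vertices; the edge `e` leads from `e / 2` to `e % 2 ^ H`. -/
def pathEdge (H p y i : ℕ) : ℕ := (p * 2 ^ (i + 1) + y / 2 ^ (H - i - 1)) % 2 ^ (H + 1)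

/-- The `i`-th vertex on the path from `p` to `y` in the de Bruijn graph on `2 ^ H` vertices. -/
def pathVertex (H p y i : ℕ) : ℕ := (p * 2 ^ i + y / 2 ^ (H - i)) % 2 ^ H

theorem pathEdge_lt (H p y i : ℕ) : pathEdge H p y i < 2 ^ (H + 1) :=
  Nat.mod_lt _ (by positivity)

/-- Write p and y as words of H bits. Vertex i is the window of H bits at position i of the word py,
and edge i the window of H + 1 bits; dropping its last or first bit gives its two ends. -/
theorem pathEdge_div {H p y i : ℕ} (hi : i < H) : pathEdge H p y i / 2 = pathVertex H p y i := by
  rw [pathEdge, pathVertex, pow_succ' 2 H, Nat.mod_mul_right_div_self]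
  obtain ⟨k, rfl⟩ : ∃ k, H = i + 1 + k := ⟨H - i - 1, by omega⟩
  rw [show i + 1 + k - i - 1 = k by omega, show i + 1 + k - i = k + 1 by omega, pow_succ 2 k,
    ← Nat.div_div_eq_div_mul, show p * 2 ^ (i + 1) = 2 * (p * 2 ^ i) by ring,
    Nat.mul_add_div (by norm_num)]

theorem pathEdge_mod (H p y i : ℕ) :
    pathEdge H p y i % 2 ^ H = pathVertex H p y (i + 1) := by
  rw [pathEdge, pathVertex, Nat.mod_mod_of_dvd _ (pow_dvd_pow 2 (Nat.le_succ H)), Nat.sub_sub]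

theorem pathVertex_zero {H p y : ℕ} (hp : p < 2 ^ H) (hy : y < 2 ^ H) :
    pathVertex H p y 0 = p := by
  simp [pathVertex, Nat.div_eq_of_lt hy, Nat.mod_eq_of_lt hp]

theorem pathVertex_last {H p y : ℕ} (hy : y < 2 ^ H) : pathVertex H p y H = y := by
  simp [pathVertex, Nat.mod_eq_of_lt hy]

theorem sum_range_mul_eq (F : ℕ → ℝ) (a b : ℕ) :
    ∑ x ∈ Finset.range (a * b), F x =
      ∑ s ∈ Finset.range a, ∑ t ∈ Finset.range b, F (b * s + t) := by
  induction a with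
  | zero => simp
  | succ a ih =>
    rw [Nat.succ_mul, Finset.sum_range_add, ih, Finset.sum_range_succ, mul_comm a b]

/-- Over all pairs of end points, the `i`-th edge of the path is equidistributed. -/
theorem two_mul_sum_pathEdge {H i : ℕ} (hi : i < H) (G : ℕ → ℝ) :
    2 * ∑ p ∈ Finset.range (2 ^ H), ∑ y ∈ Finset.range (2 ^ H), G (pathEdge H p y i) =
      2 ^ H * ∑ e ∈ Finset.range (2 ^ (H + 1)), G e := by
  obtain ⟨k, rfl⟩ : ∃ k, H = i + 1 + k := ⟨H - i - 1, by omega⟩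
  have hp : 2 ^ (i + 1 + k) = 2 ^ i * 2 ^ (k + 1) := by rw [← pow_add]; congr 1; omega
  have hy : 2 ^ (i + 1 + k) = 2 ^ (i + 1) * 2 ^ k := pow_add _ _ _
  have he : 2 ^ (i + 1 + k + 1) = 2 ^ (k + 1) * 2 ^ (i + 1) := by rw [← pow_add]; congr 1; omega
  -- The edge sees only the last k + 1 bits t of p and the first i + 1 bits s' of y, which determine
  -- it bijectively. The remaining i + k = H - 1 bits are free, so every edge occurs 2^(H-1) times.
  have key : ∀ s, ∀ t < 2 ^ (k + 1), ∀ s' < 2 ^ (i + 1), ∀ t' < 2 ^ k,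
      pathEdge (i + 1 + k) (2 ^ (k + 1) * s + t) (2 ^ k * s' + t') i = 2 ^ (i + 1) * t + s' := by
    intro s t ht s' hs' t' ht'
    rw [pathEdge, show i + 1 + k - i - 1 = k by omega, Nat.mul_add_div (by positivity),
      Nat.div_eq_of_lt ht', add_zero, he,
      show (2 ^ (k + 1) * s + t) * 2 ^ (i + 1) + s' =
        2 ^ (k + 1) * 2 ^ (i + 1) * s + (2 ^ (i + 1) * t + s') by ring,
      Nat.mul_add_mod, Nat.mod_eq_of_lt]
    calc 2 ^ (i + 1) * t + s' < 2 ^ (i + 1) * t + 2 ^ (i + 1) := by omega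
      _ = (t + 1) * 2 ^ (i + 1) := by ring
      _ ≤ 2 ^ (k + 1) * 2 ^ (i + 1) := Nat.mul_le_mul_right _ ht
  have h1 : ∑ p ∈ Finset.range (2 ^ (i + 1 + k)), ∑ y ∈ Finset.range (2 ^ (i + 1 + k)),
      G (pathEdge (i + 1 + k) p y i) = ∑ s ∈ Finset.range (2 ^ i),
        ∑ t ∈ Finset.range (2 ^ (k + 1)), ∑ s' ∈ Finset.range (2 ^ (i + 1)),
          ∑ t' ∈ Finset.range (2 ^ k), G (2 ^ (i + 1) * t + s') := by
    conv_lhs =>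
      rw [hp, sum_range_mul_eq]
    refine Finset.sum_congr rfl fun s _ => Finset.sum_congr rfl fun t ht => ?_
    rw [← hp, hy, sum_range_mul_eq]
    refine Finset.sum_congr rfl fun s' hs' => Finset.sum_congr rfl fun t' ht' => ?_
    rw [key s t (Finset.mem_range.1 ht) s' (Finset.mem_range.1 hs') t' (Finset.mem_range.1 ht')]
  rw [h1, he, sum_range_mul_eq]
  simp only [Finset.sum_const, Finset.card_range, nsmul_eq_mul, ← Finset.mul_sum]
  push_cast
  ring

variable {ρ : ℕ → ℕ → ℝ}

/-- The length of an edge of the de Bruijn graph. -/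
def edgeLength (ρ : ℕ → ℕ → ℝ) (H e : ℕ) : ℝ := ρ (e / 2) (e % 2 ^ H)

/-- The sum of the lengths of the paths from `p` in the de Bruijn graph. -/
noncomputable def score (ρ : ℕ → ℕ → ℝ) (H p : ℕ) : ℝ :=
  ∑ y ∈ Finset.range (2 ^ H), ∑ i ∈ Finset.range H, edgeLength ρ H (pathEdge H p y i)

theorem sum_le_score (self : ∀ x, ρ x x = 0) (tri : ∀ x y z, ρ x z ≤ ρ x y + ρ y z) {H p : ℕ}
    (hp : p < 2 ^ H) : ∑ y ∈ Finset.range (2 ^ H), ρ p y ≤ score ρ H p := by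
  refine Finset.sum_le_sum fun y hy => ?_
  rw [Finset.mem_range] at hy
  have key : ∀ j ≤ H, ρ p (pathVertex H p y j) ≤
      ∑ i ∈ Finset.range j, edgeLength ρ H (pathEdge H p y i) := by
    intro j
    induction j with
    | zero => simp [pathVertex_zero hp hy, self]
    | succ j ih =>
      intro hj
      rw [Finset.sum_range_succ]
      refine (tri _ (pathVertex H p y j) _).trans (add_le_add (ih (by omega)) ?_)
      rw [edgeLength, pathEdge_div (by omega), pathEdge_mod]
  simpa [pathVertex_last hy] using key H le_rfl

/-- Each edge is bounded by a detour through z, and every vertex is the tail of two edges and the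
head of two. -/
theorem sum_edgeLength_le (symm : ∀ x y, ρ x y = ρ y x) (tri : ∀ x y z, ρ x z ≤ ρ x y + ρ y z)
    (H z : ℕ) : ∑ e ∈ Finset.range (2 ^ (H + 1)), edgeLength ρ H e ≤
      4 * ∑ u ∈ Finset.range (2 ^ H), ρ z u := by
  have h1 : ∑ e ∈ Finset.range (2 ^ (H + 1)), ρ z (e / 2) =
      2 * ∑ u ∈ Finset.range (2 ^ H), ρ z u := by
    rw [pow_succ, sum_range_mul_eq, Finset.mul_sum]
    refine Finset.sum_congr rfl fun u _ => ?_
    rw [Finset.sum_range_succ, Finset.sum_range_one, show (2 * u + 0) / 2 = u by omega,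
      show (2 * u + 1) / 2 = u by omega]
    ring
  have h2 : ∑ e ∈ Finset.range (2 ^ (H + 1)), ρ z (e % 2 ^ H) =
      2 * ∑ u ∈ Finset.range (2 ^ H), ρ z u := by
    have h3 : ∀ s, ∑ t ∈ Finset.range (2 ^ H), ρ z ((2 ^ H * s + t) % 2 ^ H) =
        ∑ u ∈ Finset.range (2 ^ H), ρ z u := fun s => Finset.sum_congr rfl fun t ht => by
      rw [Nat.mul_add_mod, Nat.mod_eq_of_lt (Finset.mem_range.1 ht)]
    rw [pow_succ', sum_range_mul_eq]
    simp only [h3]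
    simp
  calc ∑ e ∈ Finset.range (2 ^ (H + 1)), edgeLength ρ H e
      ≤ ∑ e ∈ Finset.range (2 ^ (H + 1)), (ρ z (e / 2) + ρ z (e % 2 ^ H)) :=
        Finset.sum_le_sum fun e _ => by
          rw [edgeLength, symm z (e / 2)]
          exact tri _ _ _
    _ = _ := by rw [Finset.sum_add_distrib, h1, h2]; ring

/-- A vertex with the minimum score is close to all points. -/
theorem dist_le_of_score_le (self : ∀ x, ρ x x = 0) (symm : ∀ x y, ρ x y = ρ y x)
    (tri : ∀ x y z, ρ x z ≤ ρ x y + ρ y z) {H p : ℕ} (hp : p < 2 ^ H)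
    (hmin : ∀ s < 2 ^ H, score ρ H p ≤ score ρ H s) (z : ℕ) :
    2 ^ H * ρ p z ≤ (2 * H + 1) * ∑ u ∈ Finset.range (2 ^ H), ρ z u := by
  set S := ∑ u ∈ Finset.range (2 ^ H), ρ z u with hS
  have hN : (0 : ℝ) < 2 ^ H := by positivity
  have h1 : 2 ^ H * score ρ H p ≤ ∑ s ∈ Finset.range (2 ^ H), score ρ H s := by
    have := Finset.sum_le_sum fun s hs => hmin s (Finset.mem_range.1 hs)
    simpa using this
  have h2 : 2 * ∑ s ∈ Finset.range (2 ^ H), score ρ H s =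
      H * (2 ^ H * ∑ e ∈ Finset.range (2 ^ (H + 1)), edgeLength ρ H e) := by
    have h3 : ∑ s ∈ Finset.range (2 ^ H), score ρ H s = ∑ i ∈ Finset.range H,
        ∑ s ∈ Finset.range (2 ^ H), ∑ y ∈ Finset.range (2 ^ H),
          edgeLength ρ H (pathEdge H s y i) := by
      simp only [score]
      rw [Finset.sum_comm]
      simp only [fun y => Finset.sum_comm (s := Finset.range (2 ^ H)) (t := Finset.range H)
        (f := fun s i => edgeLength ρ H (pathEdge H s y i))]
      rw [Finset.sum_comm]
      exact Finset.sum_congr rfl fun i _ => Finset.sum_comm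
    rw [h3, Finset.mul_sum, Finset.sum_congr rfl fun i hi =>
      two_mul_sum_pathEdge (Finset.mem_range.1 hi) (edgeLength ρ H)]
    simp
  have h4 := sum_edgeLength_le symm tri H z
  -- The minimum is at most the average score, which is H/2 times the total edge length, itself at
  -- most 4S.
  have h5 : score ρ H p ≤ 2 * H * S := by
    refine le_of_mul_le_mul_left ?_ hN
    have h6 : (H : ℝ) * (2 ^ H * ∑ e ∈ Finset.range (2 ^ (H + 1)), edgeLength ρ H e) ≤
        H * (2 ^ H * (4 * S)) := by gcongr
    linarith
  have h7 := sum_le_score self tri hp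
  calc 2 ^ H * ρ p z = ∑ u ∈ Finset.range (2 ^ H), ρ p z := by simp
    _ ≤ ∑ u ∈ Finset.range (2 ^ H), (ρ p u + ρ z u) := Finset.sum_le_sum fun u _ => by
        rw [symm z u]
        exact tri _ _ _
    _ = ∑ u ∈ Finset.range (2 ^ H), ρ p u + S := Finset.sum_add_distrib
    _ ≤ 2 * H * S + S := by linarith
    _ = _ := by ring

end DeBruijn

end MetricMedian

/-! ### The sampling algorithm -/

namespace MetricMedian

section Sampling

/-- The score of the point `p` times `c`, as a polynomial in the lengths of the edges. -/
def scorePoly (c : ℤ) (H p : ℕ) : RealPoly :=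
  (List.range (2 ^ H)).flatMap fun y => (List.range H).map fun i => (c, [pathEdge H p y i])

theorem RealPoly.eval_append (P Q : RealPoly) (a : List ℝ) :
    RealPoly.eval (P ++ Q) a = RealPoly.eval P a + RealPoly.eval Q a := by
  simp [RealPoly.eval]

theorem eval_scorePoly (ρ : ℕ → ℕ → ℝ) (c : ℤ) (H p : ℕ) :
    (scorePoly c H p).eval ((List.range (2 ^ (H + 1))).map (edgeLength ρ H)) =
      c * score ρ H p := by
  have h1 : ∀ y i, ((List.range (2 ^ (H + 1))).map (edgeLength ρ H)).getD (pathEdge H p y i) 0 =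
      edgeLength ρ H (pathEdge H p y i) := fun y i => by
    rw [List.getD_eq_getElem?_getD, List.getElem?_map, List.getElem?_range (pathEdge_lt H p y i)]
    rfl
  rw [RealPoly.eval, scorePoly, List.map_flatMap, List.flatMap_def, List.sum_flatten,
    List.map_map, score, Finset.mul_sum]
  change ((List.range (2 ^ H)).map _).sum = ((List.range (2 ^ H)).map _).sum
  congr 1
  refine List.map_congr_left fun y _ => ?_
  rw [Function.comp_apply, List.map_map, Finset.mul_sum]
  change ((List.range H).map _).sum = ((List.range H).map _).sum
  congr 1
  refine List.map_congr_left fun i _ => ?_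
  simp only [Function.comp_apply, List.map_cons, List.map_nil, List.prod_cons, List.prod_nil,
    mul_one]
  rw [h1]

/-- The best point among the first `t` points, according to the history. -/
def bestPoint (H : ℕ) (h : List Bool) (t : ℕ) : ℕ :=
  t.rec 0 fun s b => if h.getD (2 ^ (H + 1) + s) false = true then s else b

/-- Query the edges of the de Bruijn graph on the first `2 ^ H` points, find a point with the
minimum score and output it. -/
def samplingNext (H : ℕ) (h : List Bool) : Instr :=
  if h.length < 2 ^ (H + 1) then Instr.query (h.length / 2) (h.length % 2 ^ H)
  else if h.length - 2 ^ (H + 1) < 2 ^ H then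
    Instr.test (scorePoly 1 H (bestPoint H h (h.length - 2 ^ (H + 1))) ++
      scorePoly (-1) H (h.length - 2 ^ (H + 1)))
  else Instr.output (bestPoint H h (2 ^ H))

theorem primrec_pathEdge {α : Type*} [Primcodable α] {H p y i : α → ℕ} (hH : Primrec H)
    (hp : Primrec p) (hy : Primrec y) (hi : Primrec i) :
    Primrec fun a => pathEdge (H a) (p a) (y a) (i a) := by
  have two : ∀ {f : α → ℕ}, Primrec f → Primrec fun a => 2 ^ f a := fun hf =>
    primrec_pow.comp (.const 2) hf
  exact Primrec.nat_mod.comp (Primrec.nat_add.comp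
    (Primrec.nat_mul.comp hp (two (Primrec.succ.comp hi)))
    (Primrec.nat_div.comp hy (two (Primrec.nat_sub.comp (Primrec.nat_sub.comp hH hi) (.const 1)))))
    (two (Primrec.succ.comp hH))

theorem primrec_scorePoly (c : ℤ) : Primrec₂ (scorePoly c) := by
  have hm : Primrec₂ fun (u : (ℕ × ℕ) × ℕ) (i : ℕ) =>
      ((c, [pathEdge u.1.1 u.1.2 u.2 i]) : ℤ × List ℕ) := by
    refine Primrec.pair (.const c) (Primrec.list_cons.comp (primrec_pathEdge ?_ ?_ ?_ .snd)
      (.const []))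
    · exact Primrec.fst.comp (Primrec.fst.comp .fst)
    · exact Primrec.snd.comp (Primrec.fst.comp .fst)
    · exact Primrec.snd.comp .fst
  have hl : Primrec₂ fun (u : ℕ × ℕ) (y : ℕ) =>
      (List.range u.1).map fun i => ((c, [pathEdge u.1 u.2 y i]) : ℤ × List ℕ) :=
    Primrec.list_map (Primrec.list_range.comp (Primrec.fst.comp .fst)) hm
  exact Primrec.list_flatMap (Primrec.list_range.comp (primrec_pow.comp (.const 2) .fst)) hl

theorem primrec_bestPoint {α : Type*} [Primcodable α] {H t : α → ℕ} {h : α → List Bool}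
    (hH : Primrec H) (hh : Primrec h) (ht : Primrec t) :
    Primrec fun a => bestPoint (H a) (h a) (t a) := by
  have hs : Primrec₂ fun (a : α) (sb : ℕ × ℕ) =>
      if (h a).getD (2 ^ (H a + 1) + sb.1) false = true then sb.1 else sb.2 :=
    Primrec.ite (Primrec.eq.comp ((Primrec.list_getD false).comp (hh.comp .fst)
      (Primrec.nat_add.comp (primrec_pow.comp (.const 2) (Primrec.succ.comp (hH.comp .fst)))
        (Primrec.fst.comp .snd))) (.const true)) (Primrec.fst.comp .snd) (Primrec.snd.comp .snd)
  exact Primrec.nat_rec' ht (.const 0) hs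

theorem primrec_samplingNext : Primrec₂ samplingNext := by
  have hl : Primrec fun u : ℕ × List Bool => u.2.length := Primrec.list_length.comp .snd
  have hN : Primrec fun u : ℕ × List Bool => 2 ^ u.1 := primrec_pow.comp (.const 2) .fst
  have hN2 : Primrec fun u : ℕ × List Bool => 2 ^ (u.1 + 1) :=
    primrec_pow.comp (.const 2) (Primrec.succ.comp .fst)
  have ht := Primrec.nat_sub.comp hl hN2
  refine Primrec.ite (Primrec.nat_lt.comp hl hN2) ?_ (Primrec.ite (Primrec.nat_lt.comp ht hN)
    ?_ ?_)
  · exact Primrec.sumInr.comp (Primrec.sumInl.comp (Primrec.pair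
      (Primrec.nat_div.comp hl (.const 2)) (Primrec.nat_mod.comp hl hN)))
  · exact Primrec.sumInr.comp (Primrec.sumInr.comp (Primrec.list_append.comp
      ((primrec_scorePoly 1).comp .fst (primrec_bestPoint .fst .snd ht))
      ((primrec_scorePoly (-1)).comp .fst ht)))
  · exact Primrec.sumInl.comp (primrec_bestPoint .fst .snd hN)

/-- The dimension of the de Bruijn graph on about `n / k` points. -/
def sampleDim (k n : ℕ) : ℕ := Nat.log 2 (n / k)

/-- The algorithm that finds a point with the minimum score among about `n / k n` points. -/
def samplingAlgorithm (k : ℕ → ℕ) (hk : Computable k) : Algorithm where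
  next n h := samplingNext (sampleDim (k n) n) h
  computable_next := by
    have h1 : Primrec₂ sampleDim := primrec_log_two.comp (Primrec.nat_div.comp .snd .fst)
    have h2 : Computable fun u : ℕ × List Bool => sampleDim (k u.1) u.1 :=
      h1.to_comp.comp (hk.comp .fst) .fst
    exact primrec_samplingNext.to_comp.comp h2 .snd

theorem two_pow_sampleDim_le (k n : ℕ) : 2 ^ sampleDim k n ≤ max (n / k) 1 := by
  rcases Nat.eq_zero_or_pos (n / k) with h | h
  · simp [sampleDim, h]
  · exact (Nat.pow_log_le_self 2 h.ne').trans (le_max_left _ _)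

/-- Rounding the sample size to a power of two costs the factor 2. -/
theorem le_mul_two_pow_sampleDim {k n : ℕ} (hk : 1 ≤ k) : n ≤ 2 * k * 2 ^ sampleDim k n := by
  have h1 : n / k < 2 ^ (sampleDim k n + 1) := Nat.lt_pow_succ_log_self (by norm_num) _
  have h2 := Nat.lt_mul_of_div_lt h1 hk
  calc n ≤ 2 ^ (sampleDim k n + 1) * k := h2.le
    _ = _ := by ring

theorem bestPoint_append {H : ℕ} {h : List Bool} (b : Bool) {t : ℕ}
    (ht : 2 ^ (H + 1) + t ≤ h.length) : bestPoint H (h ++ [b]) t = bestPoint H h t := by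
  induction t with
  | zero => rfl
  | succ t ih =>
    have h1 := ih (by omega)
    simp only [bestPoint] at h1 ⊢
    rw [h1, List.getD_append _ _ _ _ (by omega)]

variable {n : ℕ}

/-- The metric as a function of natural numbers. -/
noncomputable def natDist [NeZero n] (m : MetricSpace (Fin n)) (x y : ℕ) : ℝ :=
  m.dist (Fin.ofNat n x) (Fin.ofNat n y)

theorem natDist_coe [NeZero n] (m : MetricSpace (Fin n)) (x y : Fin n) :
    natDist m x y = m.dist x y := by
  simp [natDist]

/-- Edges are queried in numerical order, so the answer with index e is the length of edge e. Test
number t then asks whether t scores no worse than the best point so far; the best point starts as 0,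
so the first test compares 0 with itself. -/
theorem samplingNext_reaches {A : Algorithm} [NeZero n] {H : ℕ}
    (hA : ∀ h, A.next n h = samplingNext H h) (hH : 2 ^ H ≤ n) (m : MetricSpace (Fin n)) :
    ∀ t ≤ 2 ^ H, ∃ h : List Bool,
      A.Reaches m h ((List.range (2 ^ (H + 1))).map (edgeLength (natDist m) H)) ∧
      h.length = 2 ^ (H + 1) + t ∧ bestPoint H h t < 2 ^ H ∧
      ∀ s < t, score (natDist m) H (bestPoint H h t) ≤ score (natDist m) H s := by
  have hN : 0 < 2 ^ H := by positivity
  intro t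
  induction t with
  | zero =>
    intro _
    have key : ∀ l ≤ 2 ^ (H + 1), A.Reaches m (List.replicate l true)
        ((List.range l).map (edgeLength (natDist m) H)) := by
      intro l
      induction l with
      | zero => exact fun _ => .start
      | succ l ih =>
        intro hl
        have h1 : l / 2 < n := by
          rw [pow_succ] at hl
          omega
        have h2 : l % 2 ^ H < n := (Nat.mod_lt _ hN).trans_le hH
        have h3 : A.next n (List.replicate l true) = Instr.query (l / 2) (l % 2 ^ H) := by
          rw [hA, samplingNext, List.length_replicate, if_pos (by omega)]
        have h4 := Algorithm.Reaches.query (A := A) ⟨l / 2, h1⟩ ⟨l % 2 ^ H, h2⟩ (ih (by omega)) h3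
        rw [← natDist_coe] at h4
        rw [List.replicate_succ', List.range_succ, List.map_append]
        exact h4
    exact ⟨_, key _ le_rfl, by simp, hN, by simp⟩
  | succ t ih =>
    intro ht
    obtain ⟨h, hr, hl, hb, hmin⟩ := ih (by omega)
    have h1 : A.next n h = Instr.test (scorePoly 1 H (bestPoint H h t) ++
        scorePoly (-1) H t) := by
      rw [hA, samplingNext, if_neg (by omega), if_pos (by omega), hl, Nat.add_sub_cancel_left]
    have h2 := Algorithm.Reaches.test _ hr h1
    rw [RealPoly.eval_append, eval_scorePoly, eval_scorePoly] at h2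
    refine ⟨_, h2, by simp [hl, add_assoc], ?_⟩
    have h3 : ∀ b, bestPoint H (h ++ [b]) (t + 1) = if b = true then t else bestPoint H h t := by
      intro b
      have h4 := bestPoint_append (H := H) (h := h) b (t := t) hl.ge
      have h5 : (h ++ [b]).getD (2 ^ (H + 1) + t) false = b := by
        rw [← hl]
        simp
      simp only [bestPoint] at h4 ⊢
      rw [h4, h5]
    rw [h3]
    push_cast
    split_ifs with hc
    · rw [decide_eq_true_iff] at hc
      refine ⟨by omega, fun s hs => ?_⟩
      rcases Nat.lt_succ_iff_lt_or_eq.1 hs with hs | rfl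
      · linarith [hmin s hs]
      · exact le_rfl
    · rw [decide_eq_true_iff, not_le] at hc
      refine ⟨hb, fun s hs => ?_⟩
      rcases Nat.lt_succ_iff_lt_or_eq.1 hs with hs | rfl
      · exact hmin s hs
      · linarith

/-- Moving from z to the minimizer p costs at most n · ρ(p,z) ≤ 2k · 2^H · ρ(p,z), and 2^H · ρ(p,z)
is at most 2H + 1 times the distance sum of z over the sample. -/
theorem samplingAlgorithm_spec {k : ℕ → ℕ} (hk : Computable k) (hn : 1 ≤ n) (hk1 : 1 ≤ k n)
    (m : MetricSpace (Fin n)) :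
    ∃ p, (samplingAlgorithm k hk).HaltsWith m p (2 * 2 ^ sampleDim (k n) n) ∧
      IsApproxMedian m (1 + 2 * k n * (2 * Nat.log 2 n + 1)) p := by
  have : NeZero n := ⟨by omega⟩
  set H := sampleDim (k n) n with hHdef
  have hH : 2 ^ H ≤ n :=
    (two_pow_sampleDim_le _ _).trans (max_le (Nat.div_le_self _ _) hn)
  obtain ⟨h, hr, hl, hb, hmin⟩ :=
    samplingNext_reaches (A := samplingAlgorithm k hk) (H := H) (fun _ => rfl) hH m _ le_rfl
  have hpos : ∀ x y : Fin n, 0 ≤ m.dist x y := fun x y =>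
    @dist_nonneg _ m.toPseudoMetricSpace x y
  have tri : ∀ x y z : Fin n, m.dist x z ≤ m.dist x y + m.dist y z := fun x y z =>
    @dist_triangle _ m.toPseudoMetricSpace x y z
  refine ⟨⟨bestPoint H h (2 ^ H), hb.trans_le hH⟩, ⟨h, _, hr, ?_, ?_⟩, fun z => ?_⟩
  · change samplingNext H h = _
    rw [samplingNext, if_neg (by omega), if_neg (by omega)]
  · rw [List.length_map, List.length_range, pow_succ']
  · set p : Fin n := ⟨bestPoint H h (2 ^ H), hb.trans_le hH⟩ with hp
    have h1 := dist_le_of_score_le (ρ := natDist m)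
      (fun x => m.dist_self _) (fun x y => m.dist_comm _ _) (fun x y z => tri _ _ _) hb hmin z
    change 2 ^ H * natDist m p z ≤ _ at h1
    rw [natDist_coe] at h1
    set S := ∑ y, m.dist z y with hS
    have hS0 : 0 ≤ S := Finset.sum_nonneg fun y _ => hpos z y
    have h2 : ∑ u ∈ Finset.range (2 ^ H), natDist m z u ≤ S := by
      rw [hS, Finset.sum_congr rfl fun y _ => (natDist_coe m z y).symm,
        ← Finset.sum_range fun u => natDist m z u]
      exact Finset.sum_le_sum_of_subset_of_nonneg (Finset.range_mono hH)
        fun u _ _ => hpos _ _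
    have hHlog : H ≤ Nat.log 2 n := Nat.log_mono_right (Nat.div_le_self _ _)
    have hHlog' : (H : ℝ) ≤ Nat.log 2 n := by exact_mod_cast hHlog
    have hnk : (n : ℝ) ≤ 2 * k n * 2 ^ H := by
      exact_mod_cast le_mul_two_pow_sampleDim (n := n) hk1
    calc ∑ y, m.dist p y ≤ ∑ y, (m.dist p z + m.dist z y) :=
          Finset.sum_le_sum fun y _ => tri p z y
      _ = n * m.dist p z + S := by simp [Finset.sum_add_distrib, hS]
      _ ≤ 2 * k n * 2 ^ H * m.dist p z + S := by
          have := hpos p z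
          gcongr
      _ = 2 * k n * (2 ^ H * m.dist p z) + S := by ring
      _ ≤ 2 * k n * ((2 * Nat.log 2 n + 1) * S) + S := by
          have : 2 ^ H * m.dist p z ≤ (2 * Nat.log 2 n + 1) * S :=
            h1.trans (mul_le_mul (by gcongr) h2 (Finset.sum_nonneg fun u _ => hpos _ _)
              (by positivity))
          gcongr
      _ = _ := by ring

end Sampling

end MetricMedian

/-! ### Asymptotics and the comparison of the two algorithms -/

namespace MetricMedian

theorem one_le_sparsity (n q : ℕ) : 1 ≤ sparsity n q := le_max_left _ _

theorem sparsity_anti {n q q' : ℕ} (h : q ≤ q') : sparsity n q' ≤ sparsity n q :=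
  max_le_max le_rfl (min_le_min (Nat.div_le_div_left (by omega) (by omega)) le_rfl)

theorem eventually_mul_le_of_isLittleO {q : ℕ → ℕ}
    (hq : (fun n => (q n : ℝ)) =o[atTop] (fun n => (n : ℝ))) (C : ℕ) :
    ∀ᶠ n in atTop, C * q n ≤ n := by
  have h : (0 : ℝ) < 1 / (C + 1) := by positivity
  filter_upwards [hq.bound h] with n hn
  simp only [Real.norm_natCast] at hn
  have h2 : ((C : ℝ) + 1) * q n ≤ n := by
    rw [one_div, inv_mul_eq_div, le_div_iff₀ (by positivity)] at hn
    linarith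
  have h3 : (C + 1) * q n ≤ n := by exact_mod_cast h2
  linarith [Nat.zero_le (q n)]

theorem tendsto_sparsity {q : ℕ → ℕ}
    (hq : (fun n => (q n : ℝ)) =o[atTop] (fun n => (n : ℝ))) :
    Tendsto (fun n => sparsity n (q n)) atTop atTop := by
  refine tendsto_atTop.2 fun C => ?_
  -- Averaging 2Cq ≤ n and 2C ≤ n gives C(q + 1) ≤ n.
  filter_upwards [eventually_mul_le_of_isLittleO hq (2 * C), eventually_ge_atTop (2 * C),
    eventually_ge_atTop (2 ^ (8 * C))] with n h1 h2 h3
  refine le_max_of_le_right (le_min ?_ ?_)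
  · rw [Nat.le_div_iff_mul_le (by omega)]
    linarith
  · have h4 : 8 * C ≤ Nat.log 2 n := Nat.le_log_of_pow_le (by norm_num) h3
    calc C ≤ 2 ^ C := Nat.lt_two_pow_self.le
      _ ≤ _ := Nat.pow_le_pow_right (by norm_num) (by omega)

theorem log_le_natLog (n : ℕ) : Real.log n ≤ Nat.log 2 n + 1 := by
  rcases Nat.eq_zero_or_pos n with rfl | hn
  · simp
  have h1 : (n : ℝ) ≤ 2 ^ (Nat.log 2 n + 1) := by
    exact_mod_cast (Nat.lt_pow_succ_log_self (by norm_num : 1 < 2) n).le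
  calc Real.log n ≤ Real.log (2 ^ (Nat.log 2 n + 1)) :=
        Real.log_le_log (by exact_mod_cast hn) h1
    _ = (Nat.log 2 n + 1) * Real.log 2 := by rw [Real.log_pow]; push_cast; ring
    _ ≤ (Nat.log 2 n + 1) * 1 := by
        have := Real.log_two_lt_d9
        gcongr
        linarith
    _ = _ := mul_one _

theorem natLog_le_log (n : ℕ) (hn : 1 ≤ n) : (Nat.log 2 n : ℝ) ≤ 2 * Real.log n := by
  have h1 : (2 : ℝ) ^ Nat.log 2 n ≤ n := by
    exact_mod_cast Nat.pow_log_le_self 2 (by omega)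
  have h2 := Real.log_le_log (by positivity) h1
  rw [Real.log_pow] at h2
  have h3 := Real.log_two_gt_d9
  have h4 : (0 : ℝ) ≤ Nat.log 2 n := by positivity
  nlinarith

namespace Algorithm

/-- The lower bound: the approximation ratio of an `o(n)`-query algorithm is at least
`f n * log n` up to a constant, for some computable unbounded function `f`. -/
theorem IsSublinearQuery.exists_lower_bound {A : Algorithm} (hA : A.IsSublinearQuery) :
    ∃ f : ℕ → ℕ, Computable f ∧ (∀ n, 1 ≤ n → 1 ≤ f n) ∧ Tendsto f atTop atTop ∧
      ∀ᶠ n in atTop, ∀ β : ℝ, 1 ≤ β → A.IsApproxAt n β → f n * Real.log n ≤ 224 * β := by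
  obtain ⟨q, hq, hA⟩ := hA
  obtain ⟨f, hf, hbad⟩ := exists_computable_sparsity hA
  have hlen : ∀ n, 1 ≤ n → ∃ (D : Fin n → Fin n → ℕ) (h : List Bool) (a : List ℕ) (p z : Fin n),
      A.IsBadRun D h a p z ∧ f n = sparsity n a.length ∧ a.length ≤ q n := fun n hn => by
    obtain ⟨D, h, a, p, z, H, hfn⟩ := hbad n hn
    refine ⟨D, h, a, p, z, H, hfn, ?_⟩
    -- The certificate is a genuine run on a metric space, so it makes at most q(n) queries,
    -- whichever certificate the search has found.
    obtain ⟨p', k, hp', hk⟩ := hA n hn (H.1.toMetric one_pos le_rfl)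
    have := (H.2.1.reaches H.1 one_pos le_rfl).length_answers_le_of_haltsWith hp'
    rw [List.length_map] at this
    omega
  refine ⟨f, hf, fun n hn => ?_, ?_, ?_⟩
  · obtain ⟨D, h, a, p, z, H, hfn, -⟩ := hlen n hn
    rw [hfn]
    exact one_le_sparsity _ _
  · refine tendsto_atTop_mono' atTop ?_ (tendsto_sparsity hq)
    filter_upwards [eventually_ge_atTop 1] with n hn
    obtain ⟨D, h, a, p, z, H, hfn, hl⟩ := hlen n hn
    rw [hfn]
    exact sparsity_anti hl
  · filter_upwards [eventually_ge_atTop (2 ^ 16), eventually_mul_le_of_isLittleO hq 4]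
      with n hn hqn β hβ hA'
    obtain ⟨D, h, a, p, z, ⟨hD, hr, hp, hb⟩, hfn, hl⟩ := hlen n (by omega)
    have h1 := hA'.sparsity_mul_le (by omega) (by linarith) hD hr hp
      (hb.resolve_left (by omega))
    rw [← hfn] at h1
    have h2 : 16 ≤ Nat.log 2 n := Nat.le_log_of_pow_le (by norm_num) hn
    have h3 : Nat.log 2 n + 1 ≤ 16 * (Nat.log 2 n / 8) := by omega
    have h4 : (Nat.log 2 n : ℝ) + 1 ≤ 16 * (Nat.log 2 n / 8 : ℕ) := by exact_mod_cast h3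
    have h5 := log_le_natLog n
    calc (f n : ℝ) * Real.log n ≤ f n * (16 * (Nat.log 2 n / 8 : ℕ)) := by
          gcongr
          linarith
      _ = 16 * (f n * (Nat.log 2 n / 8 : ℕ)) := by ring
      _ ≤ 16 * (7 * (β + 1)) := by gcongr
      _ ≤ _ := by linarith

theorem not_isLittleOApprox {A : Algorithm} {f : ℕ → ℕ} (hf1 : ∀ n, 1 ≤ n → 1 ≤ f n)
    (hf : ∀ᶠ n in atTop, ∀ β : ℝ, 1 ≤ β → A.IsApproxAt n β → f n * Real.log n ≤ 224 * β) :
    ¬ A.IsLittleOApprox fun n => (f n : ℝ) * Real.log n := by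
  rintro ⟨h, ho, hA⟩
  -- The lower bound needs β ≥ 1, so it is applied to max(h, 1). If the maximum is 1, it contradicts
  -- f log n ≥ 225; otherwise h ≤ f log n / 448 does.
  have hlog : ∀ᶠ n : ℕ in atTop, 225 ≤ Real.log n :=
    (Real.tendsto_log_atTop.comp tendsto_natCast_atTop_atTop).eventually_ge_atTop 225
  obtain ⟨n, hn, hn1, hb, hl⟩ := (hf.and ((eventually_ge_atTop 1).and
    ((ho.bound (by norm_num : (0 : ℝ) < 1 / 448)).and hlog))).exists
  have h1 := hn (max (h n) 1) (le_max_right _ _) ((hA n hn1).mono (le_max_left _ _))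
  have h2 : (1 : ℝ) ≤ f n := by exact_mod_cast hf1 n hn1
  have h3 : 225 ≤ (f n : ℝ) * Real.log n := by nlinarith
  rw [Real.norm_eq_abs, Real.norm_eq_abs, abs_of_nonneg (by linarith : 0 ≤ (f n : ℝ) * _)] at hb
  have h4 := le_abs_self (h n)
  rcases max_choice (h n) 1 with h5 | h5 <;> rw [h5] at h1 <;> linarith

/-- The sampling rate k must tend to infinity to save queries, but stay o(√f) to keep the ratio
small. The integer fourth root of f, plus 1, does both and is computable. -/
theorem exists_upper_bound {f : ℕ → ℕ} (hf : Computable f) (hlim : Tendsto f atTop atTop) :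
    ∃ B : Algorithm, B.IsSublinearQuery ∧ ∃ h : ℕ → ℝ,
      h =o[atTop] (fun n => Real.sqrt (f n) * Real.log n) ∧
      ∀ n, 1 ≤ n → 1 ≤ h n ∧ B.IsApproxAt n (h n) := by
  set s : ℕ → ℕ := fun n => Nat.sqrt (Nat.sqrt (f n)) with hs
  have hs1 : Computable s :=
    Primrec.nat_sqrt.to_comp.comp (Primrec.nat_sqrt.to_comp.comp hf)
  have hslim : ∀ C : ℕ, ∀ᶠ n in atTop, C ≤ s n := fun C => by
    filter_upwards [hlim.eventually_ge_atTop ((C * C) * (C * C))] with n hn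
    exact Nat.le_sqrt.2 (Nat.le_sqrt.2 hn)
  set k : ℕ → ℕ := fun n => s n + 1 with hk
  have hk1 : Computable k := Computable.succ.comp hs1
  refine ⟨samplingAlgorithm k hk1, ⟨fun n => 2 * 2 ^ sampleDim (k n) n, ?_, fun n hn m => ?_⟩,
    fun n => 1 + 2 * k n * (2 * Nat.log 2 n + 1), ?_, fun n hn => ⟨?_, fun m => ?_⟩⟩
  · refine isLittleO_iff.2 fun c hc => ?_
    obtain ⟨C, hC⟩ := exists_nat_gt (2 / c)
    filter_upwards [hslim C, eventually_ge_atTop C] with n h1 h2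
    rw [Real.norm_natCast, Real.norm_natCast]
    have hC0 : (0 : ℝ) < C := lt_trans (by positivity) hC
    have h3 : ((2 ^ sampleDim (k n) n : ℕ) : ℝ) ≤ max ((n / k n : ℕ) : ℝ) 1 := by
      exact_mod_cast two_pow_sampleDim_le (k n) n
    have h4 : (C : ℝ) ≤ n := by exact_mod_cast h2
    have h5 : max ((n / k n : ℕ) : ℝ) 1 ≤ n / C := by
      refine max_le ?_ ?_
      · refine Nat.cast_div_le.trans ?_
        have : (C : ℝ) ≤ k n := by exact_mod_cast h1.trans (Nat.le_succ _)
        gcongr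
      · rwa [one_le_div hC0]
    have h6 : 2 < C * c := (div_lt_iff₀ hc).1 hC
    have h7 : 2 * ((n : ℝ) / C) ≤ c * n := by
      rw [mul_div_assoc', div_le_iff₀ hC0]
      have : (0 : ℝ) ≤ n := by positivity
      nlinarith
    rw [Nat.cast_mul, Nat.cast_ofNat]
    linarith
  · obtain ⟨p, hp, -⟩ := samplingAlgorithm_spec hk1 hn (Nat.le_add_left 1 _) m
    exact ⟨p, _, hp, le_rfl⟩
  · refine isLittleO_iff.2 fun c hc => ?_
    -- With k ≤ 2s and log₂ n ≤ 2 log n the ratio is at most (1 + 4 · 5) · s log n = 21 · s log n.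
    -- One further factor s, once c·s ≥ 22, makes it at most c·s² log n.
    obtain ⟨C, hC⟩ := exists_nat_gt (22 / c)
    have hlog : ∀ᶠ n : ℕ in atTop, 1 ≤ Real.log n :=
      (Real.tendsto_log_atTop.comp tendsto_natCast_atTop_atTop).eventually_ge_atTop 1
    filter_upwards [hslim C, hslim 1, hlog, eventually_ge_atTop 1] with n h1 h2 h3 hn
    have h4 := natLog_le_log n hn
    have h5 : (s n : ℝ) ^ 2 ≤ Real.sqrt (f n) := by
      refine Real.le_sqrt_of_sq_le ?_
      have h6 : s n * s n ≤ Nat.sqrt (f n) := Nat.sqrt_le _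
      have h7 : Nat.sqrt (f n) * Nat.sqrt (f n) ≤ f n := Nat.sqrt_le _
      have h8 : (s n ^ 2) ^ 2 ≤ f n := by
        calc (s n ^ 2) ^ 2 = (s n * s n) * (s n * s n) := by ring
          _ ≤ Nat.sqrt (f n) * Nat.sqrt (f n) := Nat.mul_le_mul h6 h6
          _ ≤ f n := h7
      exact_mod_cast h8
    have h9 : (1 : ℝ) ≤ s n := by exact_mod_cast h2
    have h10 : 22 ≤ c * s n := by
      have : (C : ℝ) ≤ s n := by exact_mod_cast h1
      rw [div_lt_iff₀ hc] at hC
      nlinarith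
    have hkn : (k n : ℝ) ≤ 2 * s n := by
      simp only [hk]
      push_cast
      linarith
    have h11 : (0 : ℝ) ≤ Nat.log 2 n := by positivity
    rw [Real.norm_of_nonneg (by positivity), Real.norm_of_nonneg (by positivity)]
    calc 1 + 2 * (k n : ℝ) * (2 * Nat.log 2 n + 1)
        ≤ s n * Real.log n + 2 * (2 * s n) * (2 * (2 * Real.log n) + Real.log n) := by
          gcongr
          nlinarith
      _ = 21 * (s n * Real.log n) := by ring
      _ ≤ (c * s n) * (s n * Real.log n) := by
          gcongr
          linarith
      _ = c * (s n ^ 2 * Real.log n) := by ring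
      _ ≤ c * (Real.sqrt (f n) * Real.log n) := by gcongr
  · have : (0 : ℝ) ≤ 2 * k n * (2 * Nat.log 2 n + 1) := by positivity
    linarith
  · obtain ⟨p, hp, hm⟩ := samplingAlgorithm_spec hk1 hn (Nat.le_add_left 1 _) m
    exact ⟨p, _, hp, hm⟩

theorem one_le_ratio {A : Algorithm} (hA : A.IsSublinearQuery) {n : ℕ} (hn : 1 ≤ n) :
    1 ≤ A.ratio n := le_ratio hA hn fun _ hβ _ => hβ

theorem IsSublinearQuery.exists_better {A : Algorithm} (hA : A.IsSublinearQuery) :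
    ∃ f : ℕ → ℕ, Computable f ∧ (∀ n, 1 ≤ n → 1 ≤ f n) ∧ Tendsto f atTop atTop ∧
      ¬ A.IsLittleOApprox (fun n => (f n : ℝ) * Real.log n) ∧
      ∃ B : Algorithm, B.IsSublinearQuery ∧
        B.IsLittleOApprox (fun n => Real.sqrt (f n) * Real.log n) ∧
        B.ratio =o[atTop] A.ratio := by
  obtain ⟨f, hf, hf1, hlim, hlow⟩ := hA.exists_lower_bound
  obtain ⟨B, hB, h, ho, hh⟩ := exists_upper_bound hf hlim
  refine ⟨f, hf, hf1, hlim, not_isLittleOApprox hf1 hlow, B, hB,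
    ⟨h, ho, fun n hn => (hh n hn).2⟩, ?_⟩
  have h1 : B.ratio =O[atTop] h := by
    refine IsBigO.of_bound 1 ?_
    filter_upwards [eventually_ge_atTop 1] with n hn
    have h2 := one_le_ratio hB hn
    have h3 := ratio_le (hh n hn).1 (hh n hn).2
    rw [Real.norm_of_nonneg (by linarith), Real.norm_of_nonneg (by linarith), one_mul]
    exact h3
  have h2 : (fun n => Real.sqrt (f n) * Real.log n) =O[atTop] A.ratio := by
    refine IsBigO.of_bound 224 ?_
    filter_upwards [eventually_ge_atTop 1, hlow] with n hn hl
    have h3 : (f n : ℝ) * Real.log n / 224 ≤ A.ratio n := le_ratio hA hn fun β hβ hA' => by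
      linarith [hl β hβ hA']
    have h4 := one_le_ratio hA hn
    have h5 : 0 ≤ Real.log n := Real.log_natCast_nonneg n
    have h6 : Real.sqrt (f n) ≤ f n := by
      refine Real.sqrt_le_iff.2 ⟨by positivity, ?_⟩
      have : (1 : ℝ) ≤ f n := by exact_mod_cast hf1 n hn
      nlinarith
    rw [Real.norm_of_nonneg (by positivity), Real.norm_of_nonneg (by linarith)]
    calc Real.sqrt (f n) * Real.log n ≤ f n * Real.log n := by gcongr
      _ ≤ _ := by linarith
  exact (h1.trans_isLittleO ho).trans_isBigO h2

end Algorithm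

end MetricMedian

theorem mainTheorem6 :
    (¬ ∃ A : MetricMedian.Algorithm, A.IsAsymptoticallyBest) ∧
    ∀ A : MetricMedian.Algorithm, A.IsSublinearQuery →
      ∃ f : ℕ → ℕ, Computable f ∧ (∀ n, 1 ≤ n → 1 ≤ f n) ∧ Tendsto f atTop atTop ∧
        ¬ A.IsLittleOApprox (fun n => (f n : ℝ) * Real.log n) ∧
        ∃ B : MetricMedian.Algorithm, B.IsSublinearQuery ∧
          B.IsLittleOApprox (fun n => Real.sqrt (f n) * Real.log n) ∧
          B.ratio =o[atTop] A.ratio := by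
  refine ⟨?_, fun A hA => hA.exists_better⟩
  rintro ⟨A, hA, hbest⟩
  obtain ⟨f, -, -, -, -, B, hB, -, ho⟩ := hA.exists_better
  -- Otherwise the ratio of B would be little-o of itself, although it is at least 1.
  refine isLittleO_irrefl ?_ (ho.trans_isBigO (hbest B hB))
  refine Eventually.frequently ?_
  filter_upwards [eventually_ge_atTop 1] with n hn
  exact (zero_lt_one.trans_le (MetricMedian.Algorithm.one_le_ratio hB hn)).ne'
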